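/- **Setting.** For each $n\in\mathbb N$ let $0<p=p_n\le \tfrac12$, $0<\rho=\rho_n<1$ and let $s=s_n\le n$ be a nonnegative integer; put $\gamma=\gamma_n=\frac{\rho(1-p)}{p}$. Under the null hypothesis $\mathbf G_1,\mathbf G_2$ are independent Erdős–Rényi graphs $\mathcal G(n,p)$ on $n$ labelled vertices. Under the alternative there is a uniformly random bijection $\pi^*:V(\mathbf G_1)\to V(\mathbf G_2)$ such that, given $\pi^*$, the pairs of edge indicators $\big(\mathbf 1\{uv\in E(\mathbf G_1)\},\mathbf 1\{\pi^*(u)\pi^*(v)\in E(\mathbf G_2)\}\big)$, over unordered pairs $u\neq v$, are independent, each a pair of Bernoulli variables with mean $p$ and correlation coefficient $\rho$ (so that both edges are present with probability $p^2+\rho p(1-p)$). In both cases vertex sets $V(G_1)\subseteq V(\mathbf G_1)$ and $V(G_2)\subseteq V(\mathbf G_2)$ of size $s$ are drawn uniformly at random, independently of each other and of everything else, and the induced subgraphs $G_1,G_2$ (with their vertex labels) are observed. Let $\mathcal P_0$ and $\mathcal P_1$ be the laws of $(G_1,G_2)$ under the null and the alternative, and $\mathsf{TV}(\mathcal P_0,\mathcal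 P_1)=\frac12\sum|\mathcal P_0-\mathcal P_1|$. **Proposition 4.6.** Suppose that, as $n\to\infty$, $p=n^{-o(1)}$ (that is, $p=n^{-a_n}$ for large $n$, with $a_n\to0$) and $\gamma\to\infty$. If there is a constant $\delta>0$ such that $$\frac{s^2}{n}\,p^2\,\gamma^{4/3+\delta}\le \log n$$ for all sufficiently large $n$, then $\mathsf{TV}(\mathcal P_0,\mathcal P_1)\to 0$ as $n\to\infty$. -/

import Mathlib

open Filter Topology
open scoped ENNReal

noncomputable section

namespace SampledER

/-- Relative signal strength `γ = (p² + ρ p (1 - p)) / p² - 1 = ρ (1 - p) / p`. -/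
def gam (p ρ : ℝ) : ℝ := ρ * (1 - p) / p

/-- Total variation distance `½ ∑ₓ |P x - Q x|` of two discrete laws. -/
def tv {α : Type*} (P Q : PMF α) : ℝ :=
  1 / 2 * ∑' x, |(P x).toReal - (Q x).toReal|

/-- Mass function of `Bern(p, p, ρ)`: a pair of Bernoulli variables, both with mean `p` and with
correlation coefficient `ρ`. -/
def bernPairMass (p ρ : ℝ) : Bool × Bool → ℝ
  | (true, true) => p ^ 2 + ρ * p * (1 - p)
  | (true, false) => p * (1 - p) * (1 - ρ)
  | (false, true) => p * (1 - p) * (1 - ρ)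
  | (false, false) => (1 - p) ^ 2 + ρ * p * (1 - p)

theorem bernPairMass_nonneg (p ρ : unitInterval) (x : Bool × Bool) :
    0 ≤ bernPairMass p ρ x := by
  have hp := p.2.1
  have hp' : (0 : ℝ) ≤ 1 - p := sub_nonneg.2 p.2.2
  have hr := ρ.2.1
  have hr' : (0 : ℝ) ≤ 1 - ρ := sub_nonneg.2 ρ.2.2
  rcases x with ⟨_ | _, _ | _⟩ <;> simp only [bernPairMass] <;> positivity

/-- The bivariate Bernoulli law `Bern(p, p, ρ)`. -/
def bernPair (p ρ : unitInterval) : PMF (Bool × Bool) :=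
  PMF.ofFintype (fun x => ENNReal.ofReal (bernPairMass p ρ x)) (by
    rw [← ENNReal.ofReal_sum_of_nonneg (fun x _ => bernPairMass_nonneg p ρ x)]
    simp only [Fintype.sum_prod_type, Fintype.sum_bool, bernPairMass]
    rw [← ENNReal.ofReal_one]
    congr 1
    ring)

/-- The law of a family, indexed by a finite type, of independent variables of law `μ`. -/
def iid (ι : Type*) {α : Type*} [Fintype ι] [DecidableEq ι] [Fintype α] (μ : PMF α) :
    PMF (ι → α) :=
  PMF.ofFintype (fun x => ∏ i, μ (x i)) (by
    rw [← Fintype.piFinset_univ, ← Finset.prod_univ_sum]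
    have h : ∑ a, μ a = 1 := by exact (tsum_fintype _).symm.trans μ.tsum_coe
    simp [h])

/-- The potential edges on the vertex set `{0, …, n - 1}`: unordered pairs of distinct vertices. -/
abbrev PotentialEdge (n : ℕ) : Type := {e : Sym2 (Fin n) // ¬ e.IsDiag}

/-- The graph whose edges are the potential edges marked `true`. -/
def graphOf {n : ℕ} (x : PotentialEdge n → Bool) : SimpleGraph (Fin n) :=
  SimpleGraph.fromEdgeSet {e | ∃ h : ¬ e.IsDiag, x ⟨e, h⟩ = true}

instance measurableSingletonClass_simpleGraph (n : ℕ) :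
    MeasurableSingletonClass (SimpleGraph (Fin n)) where
  measurableSet_singleton G := by
    have h : ({G} : Set (SimpleGraph (Fin n))) =
        SimpleGraph.edgeSet ⁻¹' {G.edgeSet} := by
      ext H
      simp
    rw [h]
    exact SimpleGraph.measurable_edgeSet (measurableSet_singleton _)

/-- Law of the parent graphs under the null hypothesis: two independent Erdős–Rényi graphs
`G(n, p)`. -/
def nullPair (n : ℕ) (p : unitInterval) : PMF (SimpleGraph (Fin n) × SimpleGraph (Fin n)) :=
  (SimpleGraph.binomialRandom (Fin n) p).toPMF.bind fun G₁ =>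
    (SimpleGraph.binomialRandom (Fin n) p).toPMF.map fun G₂ => (G₁, G₂)

/-- Law of the parent graphs in the correlated Erdős–Rényi model given the latent bijection `π`:
independently over the potential edges `e` of the first graph, the indicators of `e` in the first
graph and of `π e` in the second one have the law `Bern(p, p, ρ)`. -/
def correlatedPair (n : ℕ) (p ρ : unitInterval) (π : Equiv.Perm (Fin n)) :
    PMF (SimpleGraph (Fin n) × SimpleGraph (Fin n)) :=
  (iid (PotentialEdge n) (bernPair p ρ)).map fun x =>
    (graphOf fun e => (x e).1, (graphOf fun e => (x e).2).map π)

/-- Law of the parent graphs under the alternative: the latent bijection is uniformly random. -/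
def alternativePair (n : ℕ) (p ρ : unitInterval) :
    PMF (SimpleGraph (Fin n) × SimpleGraph (Fin n)) :=
  (PMF.uniformOfFintype (Equiv.Perm (Fin n))).bind (correlatedPair n p ρ)

/-- A graph on a subset of `{0, …, n - 1}`: a vertex set together with a graph on it. -/
abbrev Observed (n : ℕ) : Type :=
  Σ S : Finset (Fin n), SimpleGraph (S : Set (Fin n))

/-- The induced subgraph of `G` on `S`, as an observation. -/
def observe {n : ℕ} (G : SimpleGraph (Fin n)) (S : Finset (Fin n)) : Observed n :=
  ⟨S, G.induce (S : Set (Fin n))⟩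

/-- A uniformly random set of `s` vertices out of `n`. -/
def uniformSubset (n s : ℕ) (hs : s ≤ n) : PMF (Finset (Fin n)) :=
  PMF.uniformOfFinset (Finset.powersetCard s Finset.univ)
    (Finset.powersetCard_nonempty.2 (by simpa using hs))

/-- Law of the two sampled induced subgraphs: the parent graphs have law `μ`, and the two vertex
sets are independent uniform `s`-subsets, independent of the parent graphs. -/
def sampled (n s : ℕ) (hs : s ≤ n) (μ : PMF (SimpleGraph (Fin n) × SimpleGraph (Fin n))) :
    PMF (Observed n × Observed n) :=
  μ.bind fun G =>
    (uniformSubset n s hs).bind fun S₁ =>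
      (uniformSubset n s hs).map fun S₂ => (observe G.1 S₁, observe G.2 S₂)

/-- The law `𝒫₀` of the sampled pair under the null hypothesis. -/
def P₀ (n s : ℕ) (hs : s ≤ n) (p : unitInterval) : PMF (Observed n × Observed n) :=
  sampled n s hs (nullPair n p)

/-- The law `𝒫₁` of the sampled pair under the alternative hypothesis. -/
def P₁ (n s : ℕ) (hs : s ≤ n) (p ρ : unitInterval) : PMF (Observed n × Observed n) :=
  sampled n s hs (alternativePair n p ρ)

end SampledER

end

/-!
For fixed vertex sets `S₁`, `S₂` of size `s`, the likelihood ratio of the observed pair is an average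
`L = 𝔼_π ∏ ℓ(x_e, y_{π e})` over a uniformly random permutation `π`, the product running over the
edges `e` inside the set `T(π)` of vertices of `S₁` that `π` maps into `S₂`: an edge with an
unobserved partner contributes a factor of conditional mean one (`expect_lik_mul_inter`,
`expect_lik_mul_filter`). By duality it is enough to show `𝔼₀ |L - 1| → 0`, uniformly in `S₁`, `S₂`
(`tv_sampled_le`).

The second moment of `L` may blow up, so `L` is truncated: only the permutations `π` are kept for
which `|T(π)|` is at most a cutoff `t` and the likelihood of each `I ⊆ T(π)` is at most `K ^ |I|`,
with `K = √n`.

*Second moment* (`expect_truncatedLR_sq_le`, `permAvg_core_le`). Two matchings interact only on a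
common core `I`, which both map onto the same subset of `S₂` (`exists_core`). On the core the
truncation bounds one of the two likelihoods by `K ^ |I|`, and the other one has mean one. The
expected number of possible cores of size `k` is at most `(s / n) ^ (2 * k)`, so that the truncated
second moment is at most `∑ₖ ((s / n) ^ 2 * √n) ^ k`. As `p` and `γ` are subpolynomial, the sample
size bound gives `s ^ 2 / n = n ^ o(1)`, and the sum is `1 + o(1)`.

*Truncation* (`expect_sub_truncatedLR_le`). The mean of `|T(π)|` is `s ^ 2 / n`, so `|T(π)| ≤ t`
has probability tending to one for `t = (s ^ 2 / n + 1) * γ ^ (1 / 6)`. Under the planted law, a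
Chernoff bound with exponent `1 / 6` gives probability at most
`(n ^ (- 1 / 12) * exp (7 * p ^ 2 * γ ^ (7 / 6) * t)) ^ |I|` for a given `I` to violate its bound
(`expect_lik_tail_le`, `pairLR_moment_le`), because `I` spans at most `|I| * t` edges. The
hypothesis on `s` makes `p ^ 2 * γ ^ (7 / 6) * t` negligible against `log n`, and the union bound
over all `I ⊆ T(π)` costs only a factor `t = n ^ o(1)` for each vertex of `I`.
-/

noncomputable section

namespace SampledER

/-! ### Expectations under a product of Bernoulli laws -/

/-- Mass function of the Bernoulli law with mean `p`. -/
def bern (p : ℝ) : Bool → ℝ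
  | true => p
  | false => 1 - p

theorem sum_bern (p : ℝ) : ∑ b, bern p b = 1 := by simp [bern]

theorem bern_nonneg {p : ℝ} (h0 : 0 ≤ p) (h1 : p ≤ 1) (b : Bool) : 0 ≤ bern p b := by
  cases b <;> simp [bern, h0, h1]

theorem bern_pos {p : ℝ} (h0 : 0 < p) (h1 : p < 1) (b : Bool) : 0 < bern p b := by
  cases b <;> simp [bern, h0, h1]

theorem _root_.DependsOn.update_eq {ι β γ : Type*} [DecidableEq ι] {h : (ι → γ) → β} {S : Set ι}
    (hh : DependsOn h S) {i : ι} (hi : i ∉ S) (z : ι → γ) (b : γ) :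
    h (Function.update z i b) = h z :=
  hh fun _ hj => Function.update_of_ne (fun e => hi (by rwa [e] at hj)) _ _

theorem dependsOn_prod {ι κ : Type*} {D : Finset κ} {F : κ → (ι → Bool) → ℝ} {S : Set ι}
    (h : ∀ e ∈ D, DependsOn (F e) S) : DependsOn (fun z => ∏ e ∈ D, F e z) S :=
  fun _ _ hxy => Finset.prod_congr rfl fun e he => h e he hxy

theorem dependsOn_mul {ι : Type*} {F G : (ι → Bool) → ℝ} {S : Set ι} (hF : DependsOn F S)
    (hG : DependsOn G S) : DependsOn (fun z => F z * G z) S :=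
  fun _ _ hxy => congrArg₂ (· * ·) (hF hxy) (hG hxy)

theorem dependsOn_pair {ι : Type*} (g : Bool → Bool → ℝ) {i j : ι} {S : Set ι} (hi : i ∈ S) (hj : j ∈ S) :
    DependsOn (fun z : ι → Bool => g (z i) (z j)) S :=
  fun _ _ hxy => congrArg₂ g (hxy i hi) (hxy j hj)

section Expectation

variable {ι κ : Type*} [Fintype ι] [DecidableEq ι]

/-- Expectation of `F` under independent Bernoulli variables of mean `p` indexed by `ι`. -/
def expect (p : ℝ) (F : (ι → Bool) → ℝ) : ℝ := ∑ z, (∏ i, bern p (z i)) * F z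

theorem expect_mono {p : ℝ} (h0 : 0 ≤ p) (h1 : p ≤ 1) {F G : (ι → Bool) → ℝ}
    (h : ∀ z, F z ≤ G z) : expect p F ≤ expect p G :=
  Finset.sum_le_sum fun z _ => mul_le_mul_of_nonneg_left (h z)
    (Finset.prod_nonneg fun _ _ => bern_nonneg h0 h1 _)

theorem expect_add (p : ℝ) (F G : (ι → Bool) → ℝ) :
    expect p (fun z => F z + G z) = expect p F + expect p G := by
  simp [expect, mul_add, Finset.sum_add_distrib]

theorem expect_sub (p : ℝ) (F G : (ι → Bool) → ℝ) :
    expect p (fun z => F z - G z) = expect p F - expect p G := by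
  simp [expect, mul_sub, Finset.sum_sub_distrib]

theorem expect_const_mul (p c : ℝ) (F : (ι → Bool) → ℝ) :
    expect p (fun z => c * F z) = c * expect p F := by
  simp only [expect, Finset.mul_sum]
  exact Finset.sum_congr rfl fun z _ => by ring

theorem expect_sum (p : ℝ) (D : Finset κ) (F : κ → (ι → Bool) → ℝ) :
    expect p (fun z => ∑ k ∈ D, F k z) = ∑ k ∈ D, expect p (F k) := by
  simp only [expect, Finset.mul_sum]
  exact Finset.sum_comm

theorem sum_prod_bern (p : ℝ) : ∑ z : ι → Bool, ∏ i, bern p (z i) = 1 := by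
  rw [← Fintype.piFinset_univ, ← Finset.prod_univ_sum]
  simp only [sum_bern, Finset.prod_const_one]

theorem expect_const (p c : ℝ) : expect p (fun _ : ι → Bool => c) = c := by
  rw [expect, ← Finset.sum_mul, sum_prod_bern, one_mul]

/-- Resampling one coordinate does not change the expectation. -/
theorem expect_resample (p : ℝ) (i : ι) (F : (ι → Bool) → ℝ) :
    expect p F = expect p (fun z => ∑ b, bern p b * F (Function.update z i b)) := by
  have hL : expect p F = ∑ q : (ι → Bool) × Bool,
      (∏ j, bern p (q.1 j)) * bern p q.2 * F q.1 := by
    rw [Fintype.sum_prod_type]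
    refine Finset.sum_congr rfl fun z _ => ?_
    have : ∀ b, (∏ j, bern p (z j)) * bern p b * F z
        = ((∏ j, bern p (z j)) * F z) * bern p b := fun b => by ring
    simp only [this]
    rw [← Finset.mul_sum, sum_bern, mul_one]
  have hR : expect p (fun z => ∑ b, bern p b * F (Function.update z i b)) =
      ∑ q : (ι → Bool) × Bool,
        (∏ j, bern p (q.1 j)) * bern p q.2 * F (Function.update q.1 i q.2) := by
    rw [Fintype.sum_prod_type]
    refine Finset.sum_congr rfl fun z _ => ?_
    rw [Finset.mul_sum]
    exact Finset.sum_congr rfl fun b _ => by ring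
  rw [hL, hR]
  -- Exchanging the old and the new value of the coordinate preserves the weight.
  have hinv : Function.Involutive
      (fun q : (ι → Bool) × Bool => (Function.update q.1 i q.2, q.1 i)) := by
    rintro ⟨z, b⟩
    simp
  refine (Fintype.sum_equiv hinv.toPerm _ _ ?_).symm
  rintro ⟨z, b⟩
  simp only [Function.Involutive.coe_toPerm]
  congr 1
  rw [← Finset.mul_prod_erase _ _ (Finset.mem_univ i),
    ← Finset.mul_prod_erase _ (fun j => bern p (Function.update z i b j)) (Finset.mem_univ i)]
  have : ∏ j ∈ Finset.univ.erase i, bern p (Function.update z i b j)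
      = ∏ j ∈ Finset.univ.erase i, bern p (z j) :=
    Finset.prod_congr rfl fun j hj => by
      rw [Function.update_of_ne (Finset.ne_of_mem_erase hj)]
  rw [this]
  simp only [Function.update_self]
  ring

/-- A factor with conditional mean one given everything but one coordinate integrates out. -/
theorem expect_mul_of_cond_one (p : ℝ) {g : Bool → Bool → ℝ}
    (hg : ∀ c, ∑ b, bern p b * g b c = 1) {i j : ι} (hij : i ≠ j) {h : (ι → Bool) → ℝ}
    {S : Set ι} (hh : DependsOn h S) (hi : i ∉ S) :
    expect p (fun z => g (z i) (z j) * h z) = expect p h := by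
  rw [expect_resample p i]
  congr 1
  funext z
  simp only [Function.update_self, Function.update_of_ne hij.symm, hh.update_eq hi, ← mul_assoc]
  rw [← Finset.sum_mul, hg, one_mul]

theorem expect_mul_of_indep (p : ℝ) (g : Bool → Bool → ℝ) {i j : ι} (hij : i ≠ j)
    {h : (ι → Bool) → ℝ} {S : Set ι} (hh : DependsOn h S) (hi : i ∉ S) (hj : j ∉ S) :
    expect p (fun z => g (z i) (z j) * h z)
      = (∑ c, ∑ b, bern p c * bern p b * g b c) * expect p h := by
  rw [expect_resample p i, expect_resample p j, ← expect_const_mul]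
  congr 1
  funext z
  simp only [Function.update_self, Function.update_of_ne hij.symm,
    hh.update_eq hi, hh.update_eq hj, Finset.mul_sum, Finset.sum_mul]
  exact Finset.sum_congr rfl fun c _ => Finset.sum_congr rfl fun b _ => by ring

/-- A product of factors of conditional mean one integrates out against a function that does not
involve the coordinates `u e`. -/
theorem expect_prod_mul_of_cond_one (p : ℝ) {g : Bool → Bool → ℝ}
    (hg : ∀ c, ∑ b, bern p b * g b c = 1) {u v : κ → ι} (hu : Function.Injective u)
    (huv : ∀ e e', u e ≠ v e') (D : Finset κ) {h : (ι → Bool) → ℝ}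
    {S : Set ι} (hh : DependsOn h S) (hD : ∀ e ∈ D, u e ∉ S) :
    expect p (fun z => (∏ e ∈ D, g (z (u e)) (z (v e))) * h z) = expect p h := by
  classical
  induction D using Finset.induction_on with
  | empty => simp
  | insert e D he ih =>
    rw [← ih fun e' he' => hD e' (Finset.mem_insert_of_mem he')]
    simp only [Finset.prod_insert he, mul_assoc]
    refine expect_mul_of_cond_one p hg (huv e e) (S := {u e}ᶜ)
      (dependsOn_mul (dependsOn_prod fun e' he' => dependsOn_pair g ?_ ?_) (hh.mono ?_)) (by simp)
    · exact fun hc => he (hu hc ▸ he')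
    · exact fun hc => huv e e' hc.symm
    · intro i hi hc
      exact hD e (Finset.mem_insert_self _ _) (hc ▸ hi)

theorem expect_prod (p : ℝ) (g : Bool → Bool → ℝ) {u v : κ → ι} (hu : Function.Injective u)
    (hv : Function.Injective v) (huv : ∀ e e', u e ≠ v e') (D : Finset κ) :
    expect p (fun z => ∏ e ∈ D, g (z (u e)) (z (v e)))
      = (∑ c, ∑ b, bern p c * bern p b * g b c) ^ D.card := by
  classical
  induction D using Finset.induction_on with
  | empty => simp [expect_const]
  | insert e D he ih =>
    rw [Finset.card_insert_of_notMem he, pow_succ', ← ih]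
    simp only [Finset.prod_insert he]
    refine expect_mul_of_indep p g (huv e e) (S := {u e, v e}ᶜ)
      (dependsOn_prod fun e' he' => dependsOn_pair g ?_ ?_) (by simp) (by simp)
    · rintro (hc | hc)
      · exact he (hu hc ▸ he')
      · exact huv e' e hc
    · rintro (hc | hc)
      · exact huv e e' hc.symm
      · exact he (hv hc ▸ he')

/-- Jensen's inequality for the square. -/
theorem expect_abs_le_sqrt {p : ℝ} (h0 : 0 ≤ p) (h1 : p ≤ 1) (F : (ι → Bool) → ℝ) :
    expect p (fun z => |F z|) ≤ √(expect p (fun z => F z ^ 2)) := by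
  refine Real.le_sqrt_of_sq_le ?_
  have hw : ∀ z : ι → Bool, 0 ≤ ∏ i, bern p (z i) :=
    fun z => Finset.prod_nonneg fun _ _ => bern_nonneg h0 h1 _
  have := Finset.sum_mul_sq_le_sq_mul_sq Finset.univ
    (fun z : ι → Bool => √(∏ i, bern p (z i))) (fun z => √(∏ i, bern p (z i)) * |F z|)
  simp only [mul_pow, Real.sq_sqrt (hw _), ← mul_assoc, Real.mul_self_sqrt (hw _), sq_abs,
    sum_prod_bern, one_mul] at this
  exact this

end Expectation

/-! ### The likelihood ratio of a partial matching -/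

/-- Likelihood ratio of `Bern(p, p, ρ)` against two independent Bernoulli variables of mean `p`. -/
def pairLR (p ρ : ℝ) (b c : Bool) : ℝ := bernPairMass p ρ (b, c) / (bern p b * bern p c)

theorem bern_mul_pairLR {p ρ : ℝ} (h0 : 0 < p) (h1 : p < 1) (b c : Bool) :
    bern p b * bern p c * pairLR p ρ b c = bernPairMass p ρ (b, c) := by
  have hb := bern_pos h0 h1 b
  have hc := bern_pos h0 h1 c
  rw [pairLR]
  field_simp

theorem pairLR_comm (p ρ : ℝ) (b c : Bool) : pairLR p ρ b c = pairLR p ρ c b := by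
  cases b <;> cases c <;> simp [pairLR, bernPairMass, mul_comm]

theorem sum_bern_mul_pairLR {p ρ : ℝ} (h0 : 0 < p) (h1 : p < 1) (c : Bool) :
    ∑ b, bern p b * pairLR p ρ b c = 1 := by
  have h1' : 0 < 1 - p := sub_pos.2 h1
  cases c <;> simp only [pairLR, Fintype.sum_bool, bern, bernPairMass] <;> field_simp <;> ring

theorem pairLR_nonneg {p ρ : unitInterval} (b c : Bool) : 0 ≤ pairLR p ρ b c :=
  div_nonneg (bernPairMass_nonneg p ρ _)
    (mul_nonneg (bern_nonneg p.2.1 p.2.2 b) (bern_nonneg p.2.1 p.2.2 c))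

variable {n : ℕ}

/-- The action of a vertex permutation on potential edges. -/
def edgePerm (π : Equiv.Perm (Fin n)) : Equiv.Perm (PotentialEdge n) where
  toFun e := ⟨e.1.map π, (Sym2.isDiag_map π.injective).not.2 e.2⟩
  invFun e := ⟨e.1.map π.symm, (Sym2.isDiag_map π.symm.injective).not.2 e.2⟩
  left_inv e := Subtype.ext (by simp [Sym2.map_map])
  right_inv e := Subtype.ext (by simp [Sym2.map_map])

/-- The potential edges with both ends in `A`. -/
def edgesIn (A : Finset (Fin n)) : Finset (PotentialEdge n) :=
  Finset.univ.filter fun e => ∀ v ∈ e.1, v ∈ A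

theorem mem_edgesIn {A : Finset (Fin n)} {e : PotentialEdge n} :
    e ∈ edgesIn A ↔ ∀ v ∈ e.1, v ∈ A := by simp [edgesIn]

theorem edgesIn_mono {A B : Finset (Fin n)} (h : A ⊆ B) : edgesIn A ⊆ edgesIn B :=
  fun _ he => mem_edgesIn.2 fun v hv => h (mem_edgesIn.1 he v hv)

theorem edgesIn_univ : edgesIn (Finset.univ : Finset (Fin n)) = Finset.univ := by
  simp [edgesIn]

theorem edgesIn_empty : edgesIn (∅ : Finset (Fin n)) = ∅ := by
  refine Finset.eq_empty_of_forall_notMem fun e he => ?_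
  obtain ⟨e, _⟩ := e
  induction e with
  | _ a b => exact absurd (mem_edgesIn.1 he a (by simp)) (by simp)

theorem edgePerm_mem_edgesIn {π : Equiv.Perm (Fin n)} {A : Finset (Fin n)} {e : PotentialEdge n} :
    edgePerm π e ∈ edgesIn A ↔ ∀ v ∈ e.1, π v ∈ A := by
  simp [mem_edgesIn, edgePerm, Sym2.mem_map]

theorem card_edgesIn_le (A : Finset (Fin n)) : (edgesIn A).card ≤ A.card * A.card := by
  have h1 : (edgesIn A).card ≤ A.sym2.card :=
    Finset.card_le_card_of_injOn (fun e => e.1)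
      (fun e he => Finset.mem_sym2_iff.2 (mem_edgesIn.1 he)) Subtype.val_injective.injOn
  rw [Finset.card_sym2] at h1
  refine h1.trans ?_
  rw [Nat.choose_two_right, Nat.add_sub_cancel]
  refine Nat.div_le_of_le_mul ?_
  nlinarith [Nat.zero_le A.card, Nat.le_mul_self A.card]

/-- The edge indicators of a pair of graphs on `n` vertices. -/
abbrev PairConfig (n : ℕ) : Type := PotentialEdge n ⊕ PotentialEdge n → Bool

/-- The edge indicators that are visible when the first graph is restricted to `S₁` and the second
one to `S₂`. -/
def visible (S₁ S₂ : Finset (Fin n)) : Set (PotentialEdge n ⊕ PotentialEdge n) :=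
  {i | Sum.elim (· ∈ edgesIn S₁) (· ∈ edgesIn S₂) i}

theorem inl_mem_visible {S₁ S₂ : Finset (Fin n)} {e : PotentialEdge n} :
    Sum.inl e ∈ visible S₁ S₂ ↔ e ∈ edgesIn S₁ := Iff.rfl

theorem inr_mem_visible {S₁ S₂ : Finset (Fin n)} {e : PotentialEdge n} :
    Sum.inr e ∈ visible S₁ S₂ ↔ e ∈ edgesIn S₂ := Iff.rfl

theorem visible_mono {A A' B B' : Finset (Fin n)} (hA : A ⊆ A') (hB : B ⊆ B') :
    visible A B ⊆ visible A' B' := by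
  rintro (e | e) h
  · exact edgesIn_mono hA h
  · exact edgesIn_mono hB h

/-- Likelihood ratio of the correlated model in which only the vertices of `A` are matched, along
`π`, against two independent graphs. -/
def lik (p ρ : ℝ) (π : Equiv.Perm (Fin n)) (A : Finset (Fin n)) (z : PairConfig n) : ℝ :=
  ∏ e ∈ edgesIn A, pairLR p ρ (z (Sum.inl e)) (z (Sum.inr (edgePerm π e)))

theorem lik_empty (p ρ : ℝ) (π : Equiv.Perm (Fin n)) (z : PairConfig n) :
    lik p ρ π ∅ z = 1 := by
  rw [lik, edgesIn_empty, Finset.prod_empty]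

theorem lik_nonneg {p ρ : unitInterval} (π : Equiv.Perm (Fin n)) (A : Finset (Fin n))
    (z : PairConfig n) : 0 ≤ lik p ρ π A z := Finset.prod_nonneg fun _ _ => pairLR_nonneg _ _

theorem dependsOn_lik (p ρ : ℝ) {π : Equiv.Perm (Fin n)} {A B C : Finset (Fin n)} (hA : A ⊆ B)
    (hC : ∀ v ∈ A, π v ∈ C) : DependsOn (lik p ρ π A) (visible B C) :=
  dependsOn_prod fun _ he => dependsOn_pair _ (inl_mem_visible.2 (edgesIn_mono hA he))
    (inr_mem_visible.2 (edgePerm_mem_edgesIn.2 fun v hv => hC v (mem_edgesIn.1 he v hv)))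

section Peeling

variable {p ρ : ℝ}

theorem lik_eq_mul_of_subset {π : Equiv.Perm (Fin n)} {A B : Finset (Fin n)} (h : B ⊆ A)
    (z : PairConfig n) : lik p ρ π A z =
      (∏ e ∈ edgesIn A \ edgesIn B, pairLR p ρ (z (Sum.inl e)) (z (Sum.inr (edgePerm π e))))
        * lik p ρ π B z :=
  (Finset.prod_sdiff (edgesIn_mono h)).symm

/-- Matched vertices that are invisible in the first graph may be unmatched. -/
theorem expect_lik_mul_inter (h0 : 0 < p) (h1 : p < 1) (π : Equiv.Perm (Fin n))
    (A S C : Finset (Fin n)) {h : PairConfig n → ℝ} (hh : DependsOn h (visible S C)) :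
    expect p (fun z => lik p ρ π A z * h z) = expect p (fun z => lik p ρ π (A ∩ S) z * h z) := by
  simp only [lik_eq_mul_of_subset (Finset.inter_subset_left : A ∩ S ⊆ A), mul_assoc]
  refine expect_prod_mul_of_cond_one p (g := pairLR p ρ) (sum_bern_mul_pairLR h0 h1)
    (u := Sum.inl) (v := fun e => Sum.inr (edgePerm π e)) Sum.inl_injective (by simp) _
    (S := visible S Finset.univ)
    (dependsOn_mul (dependsOn_lik p ρ Finset.inter_subset_right (by simp))
      (hh.mono (visible_mono subset_rfl (Finset.subset_univ _)))) ?_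
  intro e he hS
  rw [Finset.mem_sdiff] at he
  rw [inl_mem_visible] at hS
  exact he.2 (mem_edgesIn.2 fun v hv =>
    Finset.mem_inter.2 ⟨mem_edgesIn.1 he.1 v hv, mem_edgesIn.1 hS v hv⟩)

/-- Matched vertices whose image is invisible in the second graph may be unmatched. -/
theorem expect_lik_mul_filter (h0 : 0 < p) (h1 : p < 1) (π : Equiv.Perm (Fin n))
    (A C S : Finset (Fin n)) {h : PairConfig n → ℝ} (hh : DependsOn h (visible C S)) :
    expect p (fun z => lik p ρ π A z * h z)
      = expect p (fun z => lik p ρ π (A.filter (π · ∈ S)) z * h z) := by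
  simp only [lik_eq_mul_of_subset (Finset.filter_subset (π · ∈ S) A), mul_assoc]
  simp_rw [fun (z : PairConfig n) (e : PotentialEdge n) =>
    pairLR_comm p ρ (z (Sum.inl e)) (z (Sum.inr (edgePerm π e)))]
  refine expect_prod_mul_of_cond_one p (g := pairLR p ρ) (sum_bern_mul_pairLR h0 h1)
    (u := fun e => Sum.inr (edgePerm π e)) (v := Sum.inl)
    (Sum.inr_injective.comp (edgePerm π).injective) (by simp) _
    (S := visible Finset.univ S)
    (dependsOn_mul (dependsOn_lik p ρ (Finset.subset_univ _) (by simp))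
      (hh.mono (visible_mono (Finset.subset_univ _) subset_rfl))) ?_
  intro e he hS
  rw [Finset.mem_sdiff] at he
  rw [inr_mem_visible, edgePerm_mem_edgesIn] at hS
  exact he.2 (mem_edgesIn.2 fun v hv =>
    Finset.mem_filter.2 ⟨mem_edgesIn.1 he.1 v hv, hS v hv⟩)

theorem expect_lik (h0 : 0 < p) (h1 : p < 1) (π : Equiv.Perm (Fin n)) (A : Finset (Fin n)) :
    expect p (lik p ρ π A) = 1 := by
  have h := expect_lik_mul_inter (ρ := ρ) h0 h1 π A ∅ ∅ (h := fun _ => 1)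
    ((dependsOn_const 1).mono (Set.empty_subset _))
  simp only [mul_one, Finset.inter_empty] at h
  rw [h]
  simp only [lik_empty]
  exact expect_const p 1

/-- Two matchings, of `A` along `π` and of `B` along `σ`, interact only through a common core `I`
that both map onto the same set: the rest of the matched vertices integrates out. -/
theorem exists_core (h0 : 0 < p) (h1 : p < 1) (π σ : Equiv.Perm (Fin n)) (A B : Finset (Fin n)) :
    ∃ I ⊆ A ∩ B, I.image π = I.image σ ∧
      ∀ h : PairConfig n → ℝ, DependsOn h (visible I (I.image π)) →
        expect p (fun z => lik p ρ π A z * lik p ρ σ B z * h z)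
          = expect p (fun z => lik p ρ π I z * lik p ρ σ I z * h z) := by
  classical
  obtain ⟨m, hm⟩ : ∃ m, A.card + B.card = m := ⟨_, rfl⟩
  induction m using Nat.strong_induction_on generalizing A B with
  | _ m ih =>
  have swap : ∀ (X Y : Finset (Fin n)) (h : PairConfig n → ℝ),
      expect p (fun z => lik p ρ π X z * lik p ρ σ Y z * h z)
        = expect p (fun z => lik p ρ σ Y z * (lik p ρ π X z * h z)) :=
    fun X Y h => congrArg _ (funext fun z => by ring)
  -- A vertex matched by only one of the two, on either side, can be dropped from that matching.
  by_cases hAB : A ⊆ B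
  swap
  · have hlt : (A ∩ B).card < A.card := Finset.card_lt_card
      (Finset.ssubset_iff_subset_ne.2 ⟨Finset.inter_subset_left, fun e => hAB (by
        rw [← e]; exact Finset.inter_subset_right)⟩)
    obtain ⟨I, hI, hπ, hE⟩ := ih _ (by omega) (A ∩ B) B rfl
    refine ⟨I, hI.trans (by grind), hπ, fun h hh => ?_⟩
    rw [← hE h hh]
    simp only [mul_assoc]
    exact expect_lik_mul_inter h0 h1 π A B Finset.univ
      (dependsOn_mul (dependsOn_lik p ρ subset_rfl (by simp))
        (hh.mono (visible_mono (hI.trans (by grind)) (Finset.subset_univ _))))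
  by_cases hBA : B ⊆ A
  swap
  · have hlt : (B ∩ A).card < B.card := Finset.card_lt_card
      (Finset.ssubset_iff_subset_ne.2 ⟨Finset.inter_subset_left, fun e => hBA (by
        rw [← e]; exact Finset.inter_subset_right)⟩)
    obtain ⟨I, hI, hπ, hE⟩ := ih _ (by omega) A (B ∩ A) rfl
    refine ⟨I, hI.trans (by grind), hπ, fun h hh => ?_⟩
    rw [← hE h hh, swap, swap]
    exact expect_lik_mul_inter h0 h1 σ B A Finset.univ
      (dependsOn_mul (dependsOn_lik p ρ subset_rfl (by simp))
        (hh.mono (visible_mono (hI.trans (by grind)) (Finset.subset_univ _))))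
  obtain rfl : A = B := hAB.antisymm hBA
  by_cases hπσ : ∀ v ∈ A, π v ∈ A.image σ
  · have hsub : A.image π ⊆ A.image σ := Finset.image_subset_iff.2 hπσ
    refine ⟨A, by simp, Finset.eq_of_subset_of_card_le hsub ?_, fun h _ => rfl⟩
    rw [Finset.card_image_of_injective _ π.injective, Finset.card_image_of_injective _ σ.injective]
  · obtain ⟨v, hv, hv'⟩ : ∃ v ∈ A, π v ∉ A.image σ := by simpa only [not_forall, exists_prop] using hπσ
    have hlt : (A.filter (π · ∈ A.image σ)).card < A.card := Finset.card_lt_card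
      (Finset.filter_ssubset.2 ⟨v, hv, hv'⟩)
    obtain ⟨I, hI, hπ, hE⟩ := ih _ (by omega) (A.filter (π · ∈ A.image σ)) A rfl
    have hIA : I ⊆ A := hI.trans Finset.inter_subset_right
    refine ⟨I, by grind, hπ, fun h hh => ?_⟩
    rw [← hE h hh]
    simp only [mul_assoc]
    exact expect_lik_mul_filter h0 h1 π A Finset.univ (A.image σ)
      (dependsOn_mul (dependsOn_lik p ρ (Finset.subset_univ _)
          fun v hv => Finset.mem_image_of_mem _ hv)
        (hh.mono (visible_mono (Finset.subset_univ _)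
          (hπ ▸ Finset.image_subset_image hIA))))

end Peeling

/-! ### Averages over uniformly random permutations -/

section PermAvg

variable {n : ℕ}

/-- Expectation over a uniformly random permutation of the vertices. -/
def permAvg (f : Equiv.Perm (Fin n) → ℝ) : ℝ := (∑ π, f π) / n.factorial

theorem permAvg_mono {f g : Equiv.Perm (Fin n) → ℝ} (h : ∀ π, f π ≤ g π) :
    permAvg f ≤ permAvg g :=
  div_le_div_of_nonneg_right (Finset.sum_le_sum fun π _ => h π) (Nat.cast_nonneg _)

theorem permAvg_add (f g : Equiv.Perm (Fin n) → ℝ) :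
    permAvg (fun π => f π + g π) = permAvg f + permAvg g := by
  simp [permAvg, Finset.sum_add_distrib, add_div]

theorem permAvg_sub (f g : Equiv.Perm (Fin n) → ℝ) :
    permAvg (fun π => f π - g π) = permAvg f - permAvg g := by
  simp [permAvg, Finset.sum_sub_distrib, sub_div]

theorem permAvg_const_mul (c : ℝ) (f : Equiv.Perm (Fin n) → ℝ) :
    permAvg (fun π => c * f π) = c * permAvg f := by
  simp [permAvg, ← Finset.mul_sum, mul_div_assoc]

theorem permAvg_mul_const (c : ℝ) (f : Equiv.Perm (Fin n) → ℝ) :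
    permAvg (fun π => f π * c) = permAvg f * c := by
  simp only [mul_comm _ c, permAvg_const_mul]

theorem permAvg_const (c : ℝ) : permAvg (fun _ : Equiv.Perm (Fin n) => c) = c := by
  have : (n.factorial : ℝ) ≠ 0 := Nat.cast_ne_zero.2 (Nat.factorial_ne_zero n)
  simp [permAvg, Fintype.card_perm, this]

theorem permAvg_sum {κ : Type*} (D : Finset κ) (f : κ → Equiv.Perm (Fin n) → ℝ) :
    permAvg (fun π => ∑ k ∈ D, f k π) = ∑ k ∈ D, permAvg (f k) := by
  simp only [permAvg, ← Finset.sum_div]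
  rw [Finset.sum_comm]

theorem expect_permAvg {ι : Type*} [Fintype ι] [DecidableEq ι] (p : ℝ)
    (F : Equiv.Perm (Fin n) → (ι → Bool) → ℝ) :
    expect p (fun z => permAvg fun π => F π z) = permAvg fun π => expect p (F π) := by
  simp only [permAvg, div_eq_inv_mul]
  rw [expect_const_mul, expect_sum]

/-- A uniformly random permutation maps `I` onto each set of the same size with the same
probability. -/
theorem permAvg_image_eq (I J : Finset (Fin n)) (h : I.card = J.card) :
    permAvg (fun π => if I.image π = J then 1 else 0) = ((n.choose I.card : ℕ) : ℝ)⁻¹ := by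
  have key : ∀ J' ∈ Finset.powersetCard I.card (Finset.univ : Finset (Fin n)),
      permAvg (fun π => if I.image π = J' then 1 else 0)
        = permAvg (fun π => if I.image π = J then (1 : ℝ) else 0) := by
    intro J' hJ'
    have hc : J'.card = J.card := (Finset.mem_powersetCard.1 hJ').2.trans h
    -- Some permutation maps `J'` onto `J`.
    let e : Equiv.Perm (Fin n) := (Finset.equivOfCardEq hc).extendSubtype
    have he : J'.image e = J := by
      refine Finset.eq_of_subset_of_card_le (Finset.image_subset_iff.2 fun x hx => ?_) ?_
      · exact Equiv.extendSubtype_mem (Finset.equivOfCardEq hc) x hx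
      · rw [Finset.card_image_of_injective _ e.injective, hc]
    unfold permAvg
    congr 1
    refine Fintype.sum_equiv (Equiv.mulLeft e) _ _ fun π => ?_
    have : I.image (e * π) = J ↔ I.image π = J' := by
      rw [← he, Equiv.Perm.coe_mul, ← Finset.image_image]
      exact (Finset.image_injective e.injective).eq_iff
    exact (if_congr this rfl rfl).symm
  have htot : ∑ J' ∈ Finset.powersetCard I.card (Finset.univ : Finset (Fin n)),
      permAvg (fun π => if I.image π = J' then (1 : ℝ) else 0) = 1 := by
    refine Eq.trans ?_ (permAvg_const (n := n) 1)
    rw [← permAvg_sum]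
    congr 1
    funext π
    rw [Finset.sum_ite_eq, if_pos]
    simp [Finset.mem_powersetCard, Finset.card_image_of_injective _ π.injective]
  rw [Finset.sum_congr rfl key, Finset.sum_const, Finset.card_powersetCard, Finset.card_univ,
    Fintype.card_fin, nsmul_eq_mul] at htot
  exact eq_inv_of_mul_eq_one_right htot

/-- The vertices of `S₁` whose partner along `π` lies in `S₂`. -/
def matched (S₁ S₂ : Finset (Fin n)) (π : Equiv.Perm (Fin n)) : Finset (Fin n) :=
  S₁.filter (π · ∈ S₂)

theorem permAvg_card_matched (S₁ S₂ : Finset (Fin n)) :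
    permAvg (fun π => ((matched S₁ S₂ π).card : ℝ)) = S₁.card * S₂.card / n := by
  have h1 : ∀ π : Equiv.Perm (Fin n), ((matched S₁ S₂ π).card : ℝ)
      = ∑ u ∈ S₁, ∑ v ∈ S₂, if ({u} : Finset (Fin n)).image π = {v} then (1 : ℝ) else 0 := by
    intro π
    simp only [Finset.image_singleton, Finset.singleton_inj, Finset.sum_ite_eq]
    simp [matched]
  simp only [h1]
  rw [permAvg_sum]
  simp only [permAvg_sum]
  have h2 : ∀ u v : Fin n, permAvg (fun π : Equiv.Perm (Fin n) =>
      if ({u} : Finset (Fin n)).image π = {v} then (1 : ℝ) else 0) = (n : ℝ)⁻¹ := by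
    intro u v
    rw [permAvg_image_eq _ _ (by simp)]
    simp
  simp only [h2, Finset.sum_const, nsmul_eq_mul]
  ring

theorem choose_mul_pow_le {s n : ℕ} (h : s ≤ n) (k : ℕ) :
    s.choose k * n ^ k ≤ n.choose k * s ^ k := by
  have key : s.descFactorial k * n ^ k ≤ n.descFactorial k * s ^ k := by
    induction k with
    | zero => simp
    | succ k ih =>
      rw [Nat.descFactorial_succ, Nat.descFactorial_succ, pow_succ, pow_succ]
      have h2 : (s - k) * n ≤ (n - k) * s := by
        rw [Nat.sub_mul, Nat.sub_mul, Nat.mul_comm n s]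
        exact Nat.sub_le_sub_left (Nat.mul_le_mul_left k h) _
      calc (s - k) * s.descFactorial k * (n ^ k * n)
          = (s.descFactorial k * n ^ k) * ((s - k) * n) := by ring
        _ ≤ (n.descFactorial k * s ^ k) * ((n - k) * s) := Nat.mul_le_mul ih h2
        _ = _ := by ring
  rw [Nat.descFactorial_eq_factorial_mul_choose, Nat.descFactorial_eq_factorial_mul_choose,
    mul_assoc, mul_assoc] at key
  exact Nat.le_of_mul_le_mul_left key (Nat.factorial_pos k)

/-- Weighted count of the common cores of two independent uniformly random matchings: the expected
number of `k`-element sets that both matchings map onto the same subset of `S₂` is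
`(C(s, k) / C(n, k)) ^ 2 ≤ (s / n) ^ (2 * k)`. -/
theorem permAvg_core_le {s : ℕ} {S₁ S₂ : Finset (Fin n)} (h₁ : S₁.card = s) (h₂ : S₂.card = s)
    {K : ℝ} (hK : 0 ≤ K) (hr : ((s : ℝ) / n) ^ 2 * K ≤ 1 / 2) :
    permAvg (fun π => permAvg fun σ => ∑ I ∈ S₁.powerset,
      if I.image π ⊆ S₂ ∧ I.image π = I.image σ then K ^ I.card else 0)
      ≤ 1 + 2 * (((s : ℝ) / n) ^ 2 * K) := by
  have hsn : s ≤ n := by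
    rw [← h₁]
    simpa using Finset.card_le_univ S₁
  set r := ((s : ℝ) / n) ^ 2 * K with hr_def
  have hr0 : 0 ≤ r := by positivity
  -- Sum over the common image `J` of the core.
  have hsplit : ∀ π σ : Equiv.Perm (Fin n), ∀ I : Finset (Fin n),
      (if I.image π ⊆ S₂ ∧ I.image π = I.image σ then K ^ I.card else 0)
        = ∑ J ∈ Finset.powersetCard I.card S₂, (K ^ I.card * if I.image π = J then 1 else 0)
            * (if I.image σ = J then 1 else 0) := by
    intro π σ I
    have hI : (I.image π).card = I.card := Finset.card_image_of_injective _ π.injective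
    simp only [mul_ite, mul_one, mul_zero, Finset.sum_ite_eq]
    by_cases hσ : I.image σ ⊆ S₂
    · have : I.image σ ∈ Finset.powersetCard I.card S₂ := Finset.mem_powersetCard.2
        ⟨hσ, Finset.card_image_of_injective _ σ.injective⟩
      rw [if_pos this]
      refine if_congr ⟨fun h => h.2, fun h => ⟨h ▸ hσ, h⟩⟩ rfl rfl
    · have : I.image σ ∉ Finset.powersetCard I.card S₂ :=
        fun h => hσ (Finset.mem_powersetCard.1 h).1
      rw [if_neg this, if_neg]
      rintro ⟨h, h'⟩
      exact hσ (h' ▸ h)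
  have hterm : ∀ I : Finset (Fin n), ∑ J ∈ Finset.powersetCard I.card S₂, permAvg (fun π =>
      permAvg fun σ => (K ^ I.card * if I.image π = J then 1 else 0)
            * (if I.image σ = J then 1 else 0))
      = K ^ I.card * (s.choose I.card : ℝ) / (n.choose I.card : ℝ) ^ 2 := by
    intro I
    have : ∀ J ∈ Finset.powersetCard I.card S₂, permAvg (fun π =>
        permAvg fun σ => (K ^ I.card * if I.image π = J then 1 else 0)
            * (if I.image σ = J then 1 else 0))
        = K ^ I.card * ((n.choose I.card : ℝ)⁻¹ * (n.choose I.card : ℝ)⁻¹) := by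
      intro J hJ
      have hc : I.card = J.card := (Finset.mem_powersetCard.1 hJ).2.symm
      simp only [permAvg_const_mul, permAvg_mul_const, permAvg_image_eq I J hc]
      ring
    rw [Finset.sum_congr rfl this, Finset.sum_const, Finset.card_powersetCard, h₂, nsmul_eq_mul]
    ring
  simp only [hsplit, permAvg_sum, hterm]
  rw [Finset.sum_powerset_apply_card
    (fun k => K ^ k * (s.choose k : ℝ) / (n.choose k : ℝ) ^ 2), h₁]
  have hk : ∀ k ∈ Finset.range (s + 1),
      s.choose k • (K ^ k * (s.choose k : ℝ) / (n.choose k : ℝ) ^ 2) ≤ r ^ k := by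
    intro k hk
    have hks : k ≤ s := Nat.lt_succ_iff.1 (Finset.mem_range.1 hk)
    have hc : (0 : ℝ) < n.choose k := Nat.cast_pos.2 (Nat.choose_pos (hks.trans hsn))
    have hle : (s.choose k : ℝ) / n.choose k ≤ ((s : ℝ) / n) ^ k := by
      rcases Nat.eq_zero_or_pos n with rfl | hn
      · obtain rfl : s = 0 := by omega
        obtain rfl : k = 0 := by omega
        simp
      · have hn' : (0 : ℝ) < (n : ℝ) ^ k := by positivity
        rw [div_pow, div_le_div_iff₀ hc hn', mul_comm ((s : ℝ) ^ k)]
        exact_mod_cast choose_mul_pow_le hsn k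
    calc s.choose k • (K ^ k * (s.choose k : ℝ) / (n.choose k : ℝ) ^ 2)
        = K ^ k * ((s.choose k : ℝ) / n.choose k) ^ 2 := by
          rw [nsmul_eq_mul]
          field_simp
      _ ≤ K ^ k * (((s : ℝ) / n) ^ k) ^ 2 := by gcongr
      _ = r ^ k := by rw [hr_def]; ring
  refine (Finset.sum_le_sum hk).trans ?_
  rw [geom_sum_eq (by linarith)]
  rw [div_le_iff_of_neg (by linarith)]
  nlinarith [pow_nonneg hr0 (s + 1)]

end PermAvg

/-! ### The truncated second moment -/

section Truncation

variable {n : ℕ} {p ρ : unitInterval}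

/-- Likelihood ratio of the sampled pair when the vertex sets are `S₁` and `S₂`. -/
def sampledLR (p ρ : ℝ) (S₁ S₂ : Finset (Fin n)) (z : PairConfig n) : ℝ :=
  permAvg fun π => lik p ρ π (matched S₁ S₂ π) z

/-- The event on which the likelihood ratio is kept: at most `t` vertices are matched, and every
set `I` of matched vertices contributes at most `K ^ |I|` to the likelihood. -/
def IsTame (p ρ K t : ℝ) (π : Equiv.Perm (Fin n)) (T : Finset (Fin n)) (z : PairConfig n) : Prop :=
  (T.card : ℝ) ≤ t ∧ ∀ I ⊆ T, lik p ρ π I z ≤ K ^ I.card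

open Classical in
/-- The likelihood ratio of the sampled pair, restricted to tame matchings. -/
def truncatedLR (p ρ K t : ℝ) (S₁ S₂ : Finset (Fin n)) (z : PairConfig n) : ℝ :=
  permAvg fun π => if IsTame p ρ K t π (matched S₁ S₂ π) z
    then lik p ρ π (matched S₁ S₂ π) z else 0

theorem truncatedLR_le (K t : ℝ) (S₁ S₂ : Finset (Fin n)) (z : PairConfig n) :
    truncatedLR p ρ K t S₁ S₂ z ≤ sampledLR p ρ S₁ S₂ z :=
  permAvg_mono fun π => by
    split_ifs
    · exact le_rfl
    · exact lik_nonneg _ _ _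

theorem expect_sampledLR (h0 : 0 < (p : ℝ)) (h1 : (p : ℝ) < 1) (S₁ S₂ : Finset (Fin n)) :
    expect p (sampledLR p ρ S₁ S₂) = 1 := by
  unfold sampledLR
  rw [expect_permAvg]
  simp only [expect_lik h0 h1, permAvg_const]

/-- On a common core one of the two likelihoods is bounded by tameness, and the other one has
mean one. -/
theorem expect_truncatedLR_sq_le (h0 : 0 < (p : ℝ)) (h1 : (p : ℝ) < 1) {K : ℝ} (hK : 0 ≤ K)
    (t : ℝ) (S₁ S₂ : Finset (Fin n)) :
    expect p (fun z => truncatedLR p ρ K t S₁ S₂ z ^ 2) ≤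
      permAvg (fun π => permAvg fun σ => ∑ I ∈ S₁.powerset,
        if I.image π ⊆ S₂ ∧ I.image π = I.image σ then K ^ I.card else 0) := by
  classical
  have hsq : ∀ z, truncatedLR p ρ K t S₁ S₂ z ^ 2 = permAvg fun π => permAvg fun σ =>
      (if IsTame p ρ K t π (matched S₁ S₂ π) z then lik p ρ π (matched S₁ S₂ π) z else 0) *
      (if IsTame p ρ K t σ (matched S₁ S₂ σ) z then lik p ρ σ (matched S₁ S₂ σ) z else 0) := by
    intro z
    simp only [permAvg_const_mul, permAvg_mul_const, sq]
    rfl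
  simp only [hsq]
  rw [expect_permAvg]
  simp only [expect_permAvg]
  refine permAvg_mono fun π => permAvg_mono fun σ => ?_
  set T := matched S₁ S₂ π with hT
  set T' := matched S₁ S₂ σ with hT'
  obtain ⟨I, hI, hπσ, hE⟩ := exists_core (ρ := ρ) h0 h1 π σ T T'
  have hIT : I ⊆ T := hI.trans Finset.inter_subset_left
  have hdep : DependsOn (fun z : PairConfig n => if lik p ρ π I z ≤ K ^ I.card then (1 : ℝ) else 0)
      (visible I (I.image π)) := fun x y hxy => by
    have := dependsOn_lik (p : ℝ) ρ (subset_refl I)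
      (fun v hv => Finset.mem_image_of_mem π hv) hxy
    simp only [this]
  have hbound : expect p (fun z =>
      (if IsTame p ρ K t π T z then lik p ρ π T z else 0) *
      (if IsTame p ρ K t σ T' z then lik p ρ σ T' z else 0)) ≤ K ^ I.card := by
    calc _ ≤ expect p (fun z => lik p ρ π T z * lik p ρ σ T' z *
            if lik p ρ π I z ≤ K ^ I.card then (1 : ℝ) else 0) := by
          refine expect_mono h0.le h1.le fun z => ?_
          have ha := lik_nonneg (p := p) (ρ := ρ) π T z
          have hb := lik_nonneg (p := p) (ρ := ρ) σ T' z
          by_cases hz : IsTame p ρ K t π T z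
          · rw [if_pos hz, if_pos (hz.2 I hIT), mul_one]
            refine mul_le_mul_of_nonneg_left ?_ ha
            split_ifs
            exacts [le_rfl, hb]
          · rw [if_neg hz, zero_mul]
            exact mul_nonneg (mul_nonneg ha hb) (by split_ifs <;> norm_num)
      _ = expect p (fun z => lik p ρ π I z * lik p ρ σ I z *
            if lik p ρ π I z ≤ K ^ I.card then (1 : ℝ) else 0) := hE _ hdep
      _ ≤ expect p (fun z => K ^ I.card * lik p ρ σ I z) := by
          refine expect_mono h0.le h1.le fun z => ?_
          have hb := lik_nonneg (p := p) (ρ := ρ) σ I z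
          split_ifs with hz
          · rw [mul_one]
            exact mul_le_mul_of_nonneg_right hz hb
          · rw [mul_zero]
            positivity
      _ = K ^ I.card := by rw [expect_const_mul, expect_lik h0 h1, mul_one]
  refine hbound.trans ?_
  have hmem : I ∈ S₁.powerset :=
    Finset.mem_powerset.2 (hIT.trans (Finset.filter_subset _ _))
  have hcond : I.image π ⊆ S₂ ∧ I.image π = I.image σ :=
    ⟨Finset.image_subset_iff.2 fun v hv => (Finset.mem_filter.1 (hIT hv)).2, hπσ⟩
  refine le_trans (le_of_eq ?_) (Finset.single_le_sum (f := fun I : Finset (Fin n) =>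
    if I.image π ⊆ S₂ ∧ I.image π = I.image σ then K ^ I.card else 0) (fun J _ => ?_) hmem)
  · simp only [if_pos hcond]
  · split_ifs <;> positivity

/-- Chernoff bound, at exponent `7 / 6`, for the likelihood of a set of matched vertices. -/
theorem expect_lik_tail_le (h0 : 0 < (p : ℝ)) (h1 : (p : ℝ) < 1) {K B t : ℝ} (hK : 0 < K)
    (hB0 : 0 ≤ B)
    (hB : ∑ c, ∑ b, bern p c * bern p b * pairLR p ρ b c ^ (7 / 6 : ℝ) ≤ Real.exp B)
    (π : Equiv.Perm (Fin n)) {I T : Finset (Fin n)} (hI : I ⊆ T) (hT : (T.card : ℝ) ≤ t) :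
    expect p (fun z => lik p ρ π T z * if K ^ I.card < lik p ρ π I z then 1 else 0)
      ≤ (K ^ (-(1 / 6) : ℝ) * Real.exp (B * t)) ^ I.card := by
  have hdep : DependsOn (fun z : PairConfig n => if K ^ I.card < lik p ρ π I z then (1 : ℝ) else 0)
      (visible I (I.image π)) := fun x y hxy => by
    have := dependsOn_lik (p : ℝ) ρ (subset_refl I)
      (fun v hv => Finset.mem_image_of_mem π hv) hxy
    simp only [this]
  rw [expect_lik_mul_inter h0 h1 π T I _ hdep, Finset.inter_eq_right.2 hI]
  have hpt : ∀ z, lik p ρ π I z * (if K ^ I.card < lik p ρ π I z then 1 else 0)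
      ≤ (K ^ (-(1 / 6) : ℝ)) ^ I.card * ∏ e ∈ edgesIn I,
        pairLR p ρ (z (Sum.inl e)) (z (Sum.inr (edgePerm π e))) ^ (7 / 6 : ℝ) := by
    intro z
    have hl := lik_nonneg (p := p) (ρ := ρ) π I z
    rw [Real.finsetProd_rpow _ _ fun _ _ => pairLR_nonneg _ _]
    change _ ≤ _ * lik p ρ π I z ^ (7 / 6 : ℝ)
    split_ifs with hz
    · have hKI : 0 < K ^ I.card := pow_pos hK _
      have hpos : 0 < lik p ρ π I z := hKI.trans hz
      have e1 : (K ^ (-(1 / 6) : ℝ)) ^ I.card = (K ^ I.card) ^ (-(1 / 6) : ℝ) := by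
        rw [← Real.rpow_natCast, ← Real.rpow_natCast, ← Real.rpow_mul hK.le,
          ← Real.rpow_mul hK.le, mul_comm]
      have e2 : lik p ρ π I z ^ (7 / 6 : ℝ) = lik p ρ π I z * lik p ρ π I z ^ (1 / 6 : ℝ) := by
        rw [show (7 / 6 : ℝ) = 1 + 1 / 6 by norm_num, Real.rpow_add hpos, Real.rpow_one]
      rw [e1, e2, Real.rpow_neg hKI.le, mul_one]
      have e3 : (K ^ I.card) ^ (1 / 6 : ℝ) ≤ lik p ρ π I z ^ (1 / 6 : ℝ) :=
        Real.rpow_le_rpow hKI.le hz.le (by norm_num)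
      have e4 : 0 < (K ^ I.card) ^ (1 / 6 : ℝ) := Real.rpow_pos_of_pos hKI _
      rw [inv_mul_eq_div, le_div_iff₀ e4]
      exact mul_le_mul_of_nonneg_left e3 hl
    · rw [mul_zero]
      have := Real.rpow_nonneg hl (7 / 6 : ℝ)
      have := Real.rpow_nonneg hK.le (-(1 / 6) : ℝ)
      positivity
  refine (expect_mono h0.le h1.le hpt).trans ?_
  rw [expect_const_mul, expect_prod (p : ℝ) (fun b c => pairLR p ρ b c ^ (7 / 6 : ℝ))
    (u := Sum.inl) (v := fun e => Sum.inr (edgePerm π e)) Sum.inl_injective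
    (Sum.inr_injective.comp (edgePerm π).injective) (by simp), mul_pow]
  have hM0 : 0 ≤ ∑ c, ∑ b, bern p c * bern p b * pairLR p ρ b c ^ (7 / 6 : ℝ) :=
    Finset.sum_nonneg fun c _ => Finset.sum_nonneg fun b _ =>
      mul_nonneg (mul_nonneg (bern_nonneg h0.le h1.le _) (bern_nonneg h0.le h1.le _))
        (Real.rpow_nonneg (pairLR_nonneg _ _) _)
  refine mul_le_mul_of_nonneg_left ?_ (pow_nonneg (Real.rpow_nonneg hK.le _) _)
  refine (pow_le_pow_left₀ hM0 hB _).trans ?_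
  rw [← Real.exp_nat_mul, ← Real.exp_nat_mul, Real.exp_le_exp]
  have hc : ((edgesIn I).card : ℝ) ≤ I.card * t := by
    have a1 : ((edgesIn I).card : ℝ) ≤ I.card * I.card := by exact_mod_cast card_edgesIn_le I
    have a2 : (I.card : ℝ) ≤ t := le_trans (by exact_mod_cast Finset.card_le_card hI) hT
    exact a1.trans (mul_le_mul_of_nonneg_left a2 (Nat.cast_nonneg _))
  calc ((edgesIn I).card : ℝ) * B ≤ I.card * t * B := mul_le_mul_of_nonneg_right hc hB0
    _ = I.card * (B * t) := by ring

/-- The truncation removes little mass: by Markov's inequality for the number of matched vertices,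
and by a union bound over the sets of matched vertices. -/
theorem expect_sub_truncatedLR_le (h0 : 0 < (p : ℝ)) (h1 : (p : ℝ) < 1) {K B t : ℝ} (hK : 0 < K)
    (hB0 : 0 ≤ B) (ht : 0 < t)
    (hB : ∑ c, ∑ b, bern p c * bern p b * pairLR p ρ b c ^ (7 / 6 : ℝ) ≤ Real.exp B)
    (S₁ S₂ : Finset (Fin n)) :
    expect p (fun z => sampledLR p ρ S₁ S₂ z - truncatedLR p ρ K t S₁ S₂ z)
      ≤ S₁.card * S₂.card / n / t
        + (Real.exp (K ^ (-(1 / 6) : ℝ) * Real.exp (B * t) * t) - 1) := by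
  classical
  set q := K ^ (-(1 / 6) : ℝ) * Real.exp (B * t) with hq
  have hq0 : 0 ≤ q := mul_nonneg (Real.rpow_nonneg hK.le _) (Real.exp_pos _).le
  simp only [sampledLR, truncatedLR, ← permAvg_sub]
  rw [expect_permAvg]
  have hexp : 0 ≤ Real.exp (q * t) - 1 := sub_nonneg.2 (Real.one_le_exp (by positivity))
  have hπ : ∀ π : Equiv.Perm (Fin n),
      expect p (fun z => lik p ρ π (matched S₁ S₂ π) z -
        if IsTame p ρ K t π (matched S₁ S₂ π) z then lik p ρ π (matched S₁ S₂ π) z else 0)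
      ≤ (matched S₁ S₂ π).card * t⁻¹ + (Real.exp (q * t) - 1) := by
    intro π
    set T := matched S₁ S₂ π
    by_cases hT : (T.card : ℝ) ≤ t
    · have hpt : ∀ z, lik p ρ π T z - (if IsTame p ρ K t π T z then lik p ρ π T z else 0)
          ≤ ∑ I ∈ T.powerset.erase ∅,
            lik p ρ π T z * if K ^ I.card < lik p ρ π I z then 1 else 0 := by
        intro z
        have hl := lik_nonneg (p := p) (ρ := ρ) π T z
        have hnn : ∀ I ∈ T.powerset.erase ∅,
            0 ≤ lik p ρ π T z * if K ^ I.card < lik p ρ π I z then (1 : ℝ) else 0 :=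
          fun I _ => mul_nonneg hl (by split_ifs <;> norm_num)
        split_ifs with hz
        · rw [sub_self]
          exact Finset.sum_nonneg hnn
        · rw [sub_zero]
          obtain ⟨I, hI, hlt⟩ : ∃ I ⊆ T, K ^ I.card < lik p ρ π I z := by
            simpa only [IsTame, hT, true_and, not_forall, not_le, exists_prop] using hz
          have hne : I ≠ ∅ := by
            rintro rfl
            simp [lik_empty] at hlt
          refine le_trans (le_of_eq ?_) (Finset.single_le_sum hnn
            (Finset.mem_erase.2 ⟨hne, Finset.mem_powerset.2 hI⟩))
          rw [if_pos hlt, mul_one]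
      have hsum : ∑ I ∈ T.powerset.erase ∅, q ^ I.card ≤ Real.exp (q * t) - 1 := by
        have h := Finset.sum_pow_mul_eq_add_pow q 1 T
        simp only [one_pow, mul_one] at h
        rw [← Finset.add_sum_erase _ _ (Finset.empty_mem_powerset T), Finset.card_empty,
          pow_zero] at h
        have h3 : (q + 1) ^ T.card ≤ Real.exp (q * t) := by
          calc (q + 1) ^ T.card ≤ Real.exp q ^ T.card :=
                pow_le_pow_left₀ (by positivity) (Real.add_one_le_exp q) _
            _ = Real.exp (T.card * q) := (Real.exp_nat_mul _ _).symm
            _ ≤ _ := Real.exp_le_exp.2 (by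
                rw [mul_comm]
                exact mul_le_mul_of_nonneg_left hT hq0)
        linarith
      calc _ ≤ expect p (fun z => ∑ I ∈ T.powerset.erase ∅,
            lik p ρ π T z * if K ^ I.card < lik p ρ π I z then 1 else 0) :=
            expect_mono h0.le h1.le hpt
        _ = ∑ I ∈ T.powerset.erase ∅, expect p (fun z =>
            lik p ρ π T z * if K ^ I.card < lik p ρ π I z then 1 else 0) := expect_sum _ _ _
        _ ≤ ∑ I ∈ T.powerset.erase ∅, q ^ I.card := Finset.sum_le_sum fun I hI =>
            expect_lik_tail_le h0 h1 hK hB0 hB π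
              (Finset.mem_powerset.1 (Finset.mem_of_mem_erase hI)) hT
        _ ≤ _ := hsum.trans (le_add_of_nonneg_left (by positivity))
    · have h3 : 1 ≤ (T.card : ℝ) * t⁻¹ := by
        rw [← div_eq_mul_inv, one_le_div ht]
        exact (not_le.1 hT).le
      calc _ ≤ expect p (lik p ρ π T) := expect_mono h0.le h1.le fun z => by
            have hl := lik_nonneg (p := p) (ρ := ρ) π T z
            split_ifs <;> linarith
        _ = 1 := expect_lik h0 h1 π T
        _ ≤ _ := by linarith
  refine (permAvg_mono hπ).trans (le_of_eq ?_)
  rw [permAvg_add, permAvg_const, permAvg_mul_const, permAvg_card_matched]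
  ring

/-- Second moment method with truncation, for fixed vertex sets. -/
theorem expect_abs_sampledLR_sub_one_le (h0 : 0 < (p : ℝ)) (h1 : (p : ℝ) < 1) {K B t : ℝ}
    (hK : 0 < K) (hB0 : 0 ≤ B) (ht : 0 < t)
    (hB : ∑ c, ∑ b, bern p c * bern p b * pairLR p ρ b c ^ (7 / 6 : ℝ) ≤ Real.exp B)
    {s : ℕ} {S₁ S₂ : Finset (Fin n)} (h₁ : S₁.card = s) (h₂ : S₂.card = s)
    (hr : ((s : ℝ) / n) ^ 2 * K ≤ 1 / 2) {η : ℝ}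
    (hη : (s : ℝ) ^ 2 / n / t
        + (Real.exp (K ^ (-(1 / 6) : ℝ) * Real.exp (B * t) * t) - 1) ≤ η) :
    expect p (fun z => |sampledLR p ρ S₁ S₂ z - 1|)
      ≤ η + √(2 * (((s : ℝ) / n) ^ 2 * K) + 2 * η) := by
  have hsub := expect_sub_truncatedLR_le (ρ := ρ) h0 h1 hK hB0 ht hB S₁ S₂
  rw [h₁, h₂, ← sq] at hsub
  replace hsub := hsub.trans hη
  have hsq := (expect_truncatedLR_sq_le (ρ := ρ) h0 h1 hK.le t S₁ S₂).trans
    (permAvg_core_le h₁ h₂ hK.le hr)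
  set L := sampledLR (p : ℝ) ρ S₁ S₂ with hL
  set L' := truncatedLR (p : ℝ) ρ K t S₁ S₂ with hL'
  have hmean : 1 - η ≤ expect p L' := by
    have := expect_sub (p : ℝ) L L'
    rw [expect_sampledLR h0 h1] at this
    linarith
  calc expect p (fun z => |L z - 1|)
      ≤ expect p (fun z => (L z - L' z) + |L' z - 1|) := expect_mono h0.le h1.le fun z => by
        have h := abs_add_le (L z - L' z) (L' z - 1)
        rw [abs_of_nonneg (sub_nonneg.2 (truncatedLR_le K t S₁ S₂ z))] at h
        simpa using h
    _ = expect p (fun z => L z - L' z) + expect p (fun z => |L' z - 1|) := expect_add _ _ _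
    _ ≤ η + √(expect p (fun z => (L' z - 1) ^ 2)) :=
        add_le_add hsub (expect_abs_le_sqrt h0.le h1.le _)
    _ ≤ _ := by
        refine add_le_add_right (Real.sqrt_le_sqrt ?_) _
        have : ∀ z, (L' z - 1) ^ 2 = (L' z ^ 2 + (-2) * L' z) + 1 := fun z => by ring
        simp only [this]
        rw [expect_add, expect_add, expect_const_mul, expect_const]
        linarith

end Truncation

/-! ### Expectations under discrete laws and total variation -/

section PMF

variable {α β : Type*} [Fintype α] [Fintype β]

/-- Expectation of a real function under a law on a finite type. -/
def mean (P : PMF α) (f : α → ℝ) : ℝ := ∑ x, (P x).toReal * f x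

theorem mean_bind (P : PMF α) (k : α → PMF β) (f : β → ℝ) :
    mean (P.bind k) f = mean P fun a => mean (k a) f := by
  simp only [mean, PMF.bind_apply, tsum_fintype]
  have : ∀ x, (∑ a, P a * k a x).toReal = ∑ a, (P a).toReal * (k a x).toReal := fun x => by
    rw [ENNReal.toReal_sum fun a _ => ENNReal.mul_ne_top (P.apply_ne_top a) ((k a).apply_ne_top x)]
    simp only [ENNReal.toReal_mul]
  simp only [this, Finset.sum_mul, Finset.mul_sum, mul_assoc]
  exact Finset.sum_comm

theorem mean_pure (a : α) (f : α → ℝ) : mean (PMF.pure a) f = f a := by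
  classical
  rw [mean, Finset.sum_eq_single a]
  · simp
  · intro b _ hb
    simp [PMF.pure_apply, hb]
  · simp

theorem mean_map (P : PMF α) (g : α → β) (f : β → ℝ) :
    mean (P.map g) f = mean P fun a => f (g a) := by
  rw [PMF.map, mean_bind]
  simp only [Function.comp_apply, mean_pure]

theorem mean_comm (P : PMF α) (Q : PMF β) (f : α → β → ℝ) :
    mean P (fun a => mean Q (f a)) = mean Q fun b => mean P fun a => f a b := by
  simp only [mean, Finset.mul_sum]
  rw [Finset.sum_comm]
  exact Finset.sum_congr rfl fun _ _ => Finset.sum_congr rfl fun _ _ => by ring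

theorem sum_toReal (P : PMF α) : ∑ x, (P x).toReal = 1 := by
  rw [← ENNReal.toReal_sum fun a _ => P.apply_ne_top a, ← tsum_fintype (L := .unconditional _),
    P.tsum_coe, ENNReal.toReal_one]

theorem mean_sub (P : PMF α) (f g : α → ℝ) :
    mean P (fun a => f a - g a) = mean P f - mean P g := by
  simp [mean, mul_sub]

theorem mean_le_of_support (P : PMF α) {f : α → ℝ} {c : ℝ} (h : ∀ x ∈ P.support, f x ≤ c) :
    mean P f ≤ c := by
  calc mean P f ≤ ∑ x, (P x).toReal * c := Finset.sum_le_sum fun x _ => by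
        by_cases hx : x ∈ P.support
        · exact mul_le_mul_of_nonneg_left (h x hx) ENNReal.toReal_nonneg
        · rw [PMF.mem_support_iff, not_not] at hx
          simp [hx]
    _ = c := by rw [← Finset.sum_mul, sum_toReal, one_mul]

/-- Dual description of the total variation distance. -/
theorem tv_le_of_forall_mean_sub_le (P Q : PMF α) {c : ℝ}
    (h : ∀ f : α → ℝ, (∀ x, |f x| ≤ 1) → mean Q f - mean P f ≤ c) : tv P Q ≤ c / 2 := by
  have := h (fun x => if (P x).toReal ≤ (Q x).toReal then 1 else -1) fun x => by
    split_ifs <;> simp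
  rw [tv, tsum_fintype]
  have e : ∑ x, |(P x).toReal - (Q x).toReal| =
      mean Q (fun x => if (P x).toReal ≤ (Q x).toReal then 1 else -1)
        - mean P (fun x => if (P x).toReal ≤ (Q x).toReal then 1 else -1) := by
    rw [mean, mean, ← Finset.sum_sub_distrib]
    refine Finset.sum_congr rfl fun x _ => ?_
    split_ifs with hx
    · rw [abs_of_nonpos (sub_nonpos.2 hx)]
      ring
    · rw [abs_of_pos (sub_pos.2 (not_le.1 hx))]
      ring
  rw [e]
  linarith

end PMF

theorem tv_nonneg {α : Type*} (P Q : PMF α) : 0 ≤ tv P Q :=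
  mul_nonneg (by norm_num) (tsum_nonneg fun _ => abs_nonneg _)

/-! ### The laws of the graphs in terms of edge indicators -/

section Graphs

variable {n : ℕ}

theorem graphOf_adj (x : PotentialEdge n → Bool) (u v : Fin n) :
    (graphOf x).Adj u v ↔ ∃ h : ¬ s(u, v).IsDiag, x ⟨s(u, v), h⟩ = true := by
  rw [graphOf, SimpleGraph.fromEdgeSet_adj]
  exact ⟨fun h => h.1, fun h => ⟨h, fun e => h.1 (by simpa using e)⟩⟩

theorem mem_edgeSet_graphOf (x : PotentialEdge n → Bool) (e : Sym2 (Fin n)) :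
    e ∈ (graphOf x).edgeSet ↔ ∃ h : ¬ e.IsDiag, x ⟨e, h⟩ = true := by
  induction e with
  | _ u v => exact graphOf_adj x u v

theorem graphOf_bijective : Function.Bijective (graphOf (n := n)) := by
  classical
  constructor
  · intro x y hxy
    funext e
    have h := mem_edgeSet_graphOf x e.1
    rw [hxy, mem_edgeSet_graphOf] at h
    simp only [e.2, not_false_eq_true, exists_true_left] at h
    exact (Bool.eq_iff_iff.2 h).symm
  · intro G
    refine ⟨fun e => decide (e.1 ∈ G.edgeSet), ?_⟩
    rw [← SimpleGraph.edgeSet_inj]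
    ext e
    rw [mem_edgeSet_graphOf]
    simp only [decide_eq_true_eq, exists_prop, and_iff_right_iff_imp]
    exact fun h => SimpleGraph.not_isDiag_of_mem_edgeSet G h

theorem graphOf_map (π : Equiv.Perm (Fin n)) (y : PotentialEdge n → Bool) :
    (graphOf y).map π = graphOf fun e => y ((edgePerm π).symm e) := by
  ext u v
  rw [SimpleGraph.map_adj', graphOf_adj]
  constructor
  · rintro ⟨huv, a, b, hab, rfl, rfl⟩
    obtain ⟨h, hy⟩ := (graphOf_adj y a b).1 hab
    refine ⟨by simpa using huv, ?_⟩
    have : (edgePerm π).symm ⟨s(π a, π b), by simpa using huv⟩ = ⟨s(a, b), h⟩ :=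
      (edgePerm π).symm_apply_apply ⟨s(a, b), h⟩
    rw [this, hy]
  · rintro ⟨huv, hy⟩
    refine ⟨by simpa using huv, π.symm u, π.symm v, ?_, by simp, by simp⟩
    exact (graphOf_adj y _ _).2 ⟨((edgePerm π).symm ⟨s(u, v), huv⟩).2, hy⟩

theorem binomialRandom_graphOf (p : unitInterval) (x : PotentialEdge n → Bool) :
    ((SimpleGraph.binomialRandom (Fin n) p).toPMF (graphOf x)).toReal = ∏ e, bern p (x e) := by
  classical
  have hset : (graphOf x).edgeSet
      = ((Finset.univ.filter fun e => x e = true).map (Function.Embedding.subtype _) :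
          Finset (Sym2 (Fin n))) := by
    ext e
    rw [mem_edgeSet_graphOf]
    simp
  have hcard : (graphOf x).edgeSet.ncard = (Finset.univ.filter fun e => x e = true).card := by
    rw [hset, Set.ncard_coe_finset, Finset.card_map]
  have htot : (Finset.univ.filter fun e => x e = true).card
      + (Finset.univ.filter fun e => ¬ x e = true).card = n.choose 2 := by
    rw [Finset.card_filter_add_card_filter_not, Finset.card_univ, Sym2.card_subtype_not_diag,
      Fintype.card_fin]
  have hprod : ∏ e, bern p (x e) = (p : ℝ) ^ (Finset.univ.filter fun e => x e = true).card
      * (1 - (p : ℝ)) ^ (Finset.univ.filter fun e => ¬ x e = true).card := by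
    have : ∀ e, bern p (x e) = if x e = true then (p : ℝ) else 1 - p := fun e => by
      cases x e <;> simp [bern]
    simp only [this, Finset.prod_ite, Finset.prod_const]
  rw [MeasureTheory.Measure.toPMF_apply, SimpleGraph.binomialRandom_singleton, hprod, hcard,
    Nat.card_eq_fintype_card, Fintype.card_fin, ← htot, Nat.add_sub_cancel_left]
  simp

open Classical in
theorem mean_binomialRandom (p : unitInterval) (F : SimpleGraph (Fin n) → ℝ) :
    mean (SimpleGraph.binomialRandom (Fin n) p).toPMF F = expect p fun x => F (graphOf x) := by
  rw [mean, expect]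
  refine (Fintype.sum_bijective graphOf graphOf_bijective _ _ fun x => ?_).symm
  rw [binomialRandom_graphOf]

theorem expect_sumElim {κ κ' : Type*} [Fintype κ] [DecidableEq κ] [Fintype κ'] [DecidableEq κ']
    (p : ℝ) (F : (κ ⊕ κ' → Bool) → ℝ) :
    expect p F = expect p fun x => expect p fun y => F (Sum.elim x y) := by
  simp only [expect, Finset.mul_sum]
  rw [← Fintype.sum_prod_type']
  refine Fintype.sum_equiv (Equiv.sumArrowEquivProdArrow _ _ _) _ _ fun z => ?_
  have : Sum.elim (fun i => z (Sum.inl i)) (fun i => z (Sum.inr i)) = z := by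
    funext i
    cases i <;> rfl
  simp only [Equiv.sumArrowEquivProdArrow, Equiv.coe_fn_mk, Function.comp_def,
    Fintype.prod_sum_type, this, mul_assoc]

/-- The pair of graphs with edge indicators `z`. -/
def graphPair (z : PairConfig n) : SimpleGraph (Fin n) × SimpleGraph (Fin n) :=
  (graphOf fun e => z (Sum.inl e), graphOf fun e => z (Sum.inr e))

open Classical in
theorem mean_nullPair (p : unitInterval) (F : SimpleGraph (Fin n) × SimpleGraph (Fin n) → ℝ) :
    mean (nullPair n p) F = expect p fun z => F (graphPair z) := by
  rw [nullPair, mean_bind]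
  simp only [mean_map, mean_binomialRandom]
  rw [expect_sumElim]
  rfl

/-- Under the correlated model with latent bijection `π`, the first coordinates of the pairs give
the first graph, and the second ones, transported along `π`, the second graph. -/
def pairConfigEquiv (π : Equiv.Perm (Fin n)) : (PotentialEdge n → Bool × Bool) ≃ PairConfig n where
  toFun x := Sum.elim (fun e => (x e).1) fun e => (x ((edgePerm π).symm e)).2
  invFun z e := (z (Sum.inl e), z (Sum.inr (edgePerm π e)))
  left_inv x := by
    funext e
    simp
  right_inv z := by
    funext i
    cases i <;> simp

open Classical in
theorem mean_correlatedPair {p ρ : unitInterval} (h0 : 0 < (p : ℝ)) (h1 : (p : ℝ) < 1)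
    (π : Equiv.Perm (Fin n)) (F : SimpleGraph (Fin n) × SimpleGraph (Fin n) → ℝ) :
    mean (correlatedPair n p ρ π) F
      = expect p fun z => lik p ρ π Finset.univ z * F (graphPair z) := by
  rw [correlatedPair, mean_map, mean, expect]
  refine Fintype.sum_equiv (pairConfigEquiv π) _ _ fun x => ?_
  have hmass : (iid (PotentialEdge n) (bernPair p ρ) x).toReal
      = ∏ e, bernPairMass p ρ (x e) := by
    simp only [iid, bernPair, PMF.ofFintype_apply, ENNReal.toReal_prod]
    exact Finset.prod_congr rfl fun e _ => ENNReal.toReal_ofReal (bernPairMass_nonneg p ρ _)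
  have hw : (∏ i, bern p (pairConfigEquiv π x i)) * lik p ρ π Finset.univ (pairConfigEquiv π x)
      = ∏ e, bernPairMass p ρ (x e) := by
    rw [Fintype.prod_sum_type, lik, edgesIn_univ,
      ← Equiv.prod_comp (edgePerm π) fun e => bern p (pairConfigEquiv π x (Sum.inr e)),
      ← Finset.prod_mul_distrib, ← Finset.prod_mul_distrib]
    refine Finset.prod_congr rfl fun e _ => ?_
    rw [bern_mul_pairLR h0 h1]
    simp [pairConfigEquiv]
  rw [hmass, ← mul_assoc, hw, graphOf_map]
  rfl

open Classical in
theorem mean_alternativePair {p ρ : unitInterval} (h0 : 0 < (p : ℝ)) (h1 : (p : ℝ) < 1)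
    (F : SimpleGraph (Fin n) × SimpleGraph (Fin n) → ℝ) :
    mean (alternativePair n p ρ) F
      = permAvg fun π => expect p fun z => lik p ρ π Finset.univ z * F (graphPair z) := by
  rw [alternativePair, mean_bind]
  simp only [mean_correlatedPair h0 h1]
  rw [mean, permAvg, Finset.sum_div]
  refine Finset.sum_congr rfl fun π _ => ?_
  rw [PMF.uniformOfFintype_apply, ENNReal.toReal_inv, ENNReal.toReal_natCast, Fintype.card_perm,
    Fintype.card_fin, div_eq_inv_mul]

theorem observe_congr {S : Finset (Fin n)} {x y : PotentialEdge n → Bool}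
    (h : ∀ e ∈ edgesIn S, x e = y e) : observe (graphOf x) S = observe (graphOf y) S := by
  have : (graphOf x).induce (S : Set (Fin n)) = (graphOf y).induce (S : Set (Fin n)) := by
    ext u v
    simp only [SimpleGraph.comap_adj, graphOf_adj]
    refine exists_congr fun hd => ?_
    rw [h]
    rw [mem_edgesIn]
    intro w hw
    rcases Sym2.mem_iff.1 hw with rfl | rfl
    exacts [u.2, v.2]
  rw [observe, observe, this]

theorem dependsOn_observe (S₁ S₂ : Finset (Fin n)) (f : Observed n × Observed n → ℝ) :
    DependsOn (fun z : PairConfig n =>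
      f (observe (graphPair z).1 S₁, observe (graphPair z).2 S₂)) (visible S₁ S₂) := by
  intro x y hxy
  have e1 := observe_congr (S := S₁) (x := fun e => x (Sum.inl e)) (y := fun e => y (Sum.inl e))
    fun e he => hxy _ (inl_mem_visible.2 he)
  have e2 := observe_congr (S := S₂) (x := fun e => x (Sum.inr e)) (y := fun e => y (Sum.inr e))
    fun e he => hxy _ (inr_mem_visible.2 he)
  exact congrArg f (Prod.ext e1 e2)

open Classical in
/-- The total variation distance is controlled, uniformly over the sampled vertex sets, by the
`L¹` distance of the likelihood ratio to one. -/
theorem tv_sampled_le {s : ℕ} (hs : s ≤ n) {p ρ : unitInterval} (h0 : 0 < (p : ℝ))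
    (h1 : (p : ℝ) < 1) {c : ℝ} (hc : ∀ S₁ S₂ : Finset (Fin n), S₁.card = s → S₂.card = s →
      expect p (fun z => |sampledLR p ρ S₁ S₂ z - 1|) ≤ c) :
    tv (P₀ n s hs p) (P₁ n s hs p ρ) ≤ c / 2 := by
  have : Fintype (Observed n) := Fintype.ofFinite _
  refine tv_le_of_forall_mean_sub_le _ _ fun f hf => ?_
  have hsampled : ∀ μ, mean (sampled n s hs μ) f = mean (uniformSubset n s hs) fun S₁ =>
      mean (uniformSubset n s hs) fun S₂ =>
        mean μ fun G => f (observe G.1 S₁, observe G.2 S₂) := by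
    intro μ
    rw [sampled, mean_bind]
    simp only [mean_bind, mean_map]
    rw [mean_comm]
    congr 1
    funext S₁
    rw [mean_comm]
  have hcard : ∀ S ∈ (uniformSubset n s hs).support, S.card = s := fun S hS => by
    rw [uniformSubset, PMF.mem_support_uniformOfFinset_iff] at hS
    exact (Finset.mem_powersetCard.1 hS).2
  rw [P₀, P₁, hsampled, hsampled, ← mean_sub]
  refine mean_le_of_support _ fun S₁ hS₁ => ?_
  rw [← mean_sub]
  refine mean_le_of_support _ fun S₂ hS₂ => ?_
  rw [mean_nullPair, mean_alternativePair h0 h1]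
  have hdep := dependsOn_observe S₁ S₂ f
  have hpeel : ∀ π : Equiv.Perm (Fin n),
      expect p (fun z => lik p ρ π Finset.univ z *
        f (observe (graphPair z).1 S₁, observe (graphPair z).2 S₂))
      = expect p (fun z => lik p ρ π (matched S₁ S₂ π) z *
        f (observe (graphPair z).1 S₁, observe (graphPair z).2 S₂)) := by
    intro π
    rw [expect_lik_mul_inter h0 h1 π _ S₁ S₂ hdep, Finset.univ_inter,
      expect_lik_mul_filter h0 h1 π _ S₁ S₂ hdep, matched]
  simp only [hpeel]
  rw [← expect_permAvg, ← expect_sub]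
  refine (expect_mono h0.le h1.le fun z => ?_).trans (hc S₁ S₂ (hcard _ hS₁) (hcard _ hS₂))
  rw [permAvg_mul_const, ← sub_one_mul]
  refine (le_abs_self _).trans ?_
  rw [abs_mul]
  exact mul_le_of_le_one_right (abs_nonneg _) (hf _)

end Graphs

/-! ### Asymptotics -/

/-- The moment of order `7 / 6` of the likelihood ratio of one pair of edges. -/
theorem pairLR_moment_le {p ρ : ℝ} (h0 : 0 < p) (h1 : p ≤ 1 / 2) (hρ0 : 0 < ρ) (hρ1 : ρ < 1)
    (hγ : 1 ≤ gam p ρ) :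
    ∑ c, ∑ b, bern p c * bern p b * pairLR p ρ b c ^ (7 / 6 : ℝ)
      ≤ Real.exp (7 * p ^ 2 * gam p ρ ^ (7 / 6 : ℝ)) := by
  set g := gam p ρ with hg
  have hq : 0 < 1 - p := by linarith
  have hpg : ρ * (1 - p) = p * g := by
    rw [hg, gam]
    field_simp
  have htt : pairLR p ρ true true = 1 + g := by
    simp only [pairLR, bernPairMass, bern, hg, gam]
    field_simp
  have htf : pairLR p ρ true false = 1 - ρ := by
    simp only [pairLR, bernPairMass, bern]
    field_simp
  have hff : pairLR p ρ false false = 1 + ρ * p / (1 - p) := by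
    simp only [pairLR, bernPairMass, bern]
    field_simp
  have b1 : (1 + g) ^ (7 / 6 : ℝ) ≤ 4 * g ^ (7 / 6 : ℝ) := by
    calc (1 + g) ^ (7 / 6 : ℝ) ≤ (2 * g) ^ (7 / 6 : ℝ) :=
          Real.rpow_le_rpow (by linarith) (by linarith) (by norm_num)
      _ = 2 ^ (7 / 6 : ℝ) * g ^ (7 / 6 : ℝ) := Real.mul_rpow (by norm_num) (by linarith)
      _ ≤ 4 * g ^ (7 / 6 : ℝ) := by
          refine mul_le_mul_of_nonneg_right ?_ (Real.rpow_nonneg (by linarith) _)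
          calc (2 : ℝ) ^ (7 / 6 : ℝ) ≤ 2 ^ (2 : ℝ) :=
                Real.rpow_le_rpow_of_exponent_le (by norm_num) (by norm_num)
            _ = 4 := by norm_num
  have b2 : (1 - ρ) ^ (7 / 6 : ℝ) ≤ 1 :=
    Real.rpow_le_one (by linarith) (by linarith) (by norm_num)
  have hu : 0 ≤ ρ * p / (1 - p) := by positivity
  have b3 : (1 + ρ * p / (1 - p)) ^ (7 / 6 : ℝ) ≤ (1 + ρ * p / (1 - p)) ^ 2 := by
    rw [← Real.rpow_natCast]
    exact Real.rpow_le_rpow_of_exponent_le (by linarith) (by norm_num)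
  have b4 : g ≤ g ^ (7 / 6 : ℝ) := by
    calc g = g ^ (1 : ℝ) := (Real.rpow_one g).symm
      _ ≤ _ := Real.rpow_le_rpow_of_exponent_le hγ (by norm_num)
  have c3 : (1 - p) * (1 - p) * (1 + ρ * p / (1 - p)) ^ 2 = (1 - p) ^ 2 + 2 * p ^ 2 * g
      + ρ ^ 2 * p ^ 2 := by
    have : (1 - p) * (1 + ρ * p / (1 - p)) = 1 - p + ρ * p := by field_simp
    calc _ = ((1 - p) * (1 + ρ * p / (1 - p))) ^ 2 := by ring
      _ = (1 - p) ^ 2 + 2 * p * (ρ * (1 - p)) + ρ ^ 2 * p ^ 2 := by rw [this]; ring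
      _ = _ := by rw [hpg]; ring
  have c4 : ρ ^ 2 * p ^ 2 ≤ p ^ 2 * g := by
    have e : p ^ 2 * g = p * (ρ * (1 - p)) := by rw [hpg]; ring
    rw [e]
    have : ρ * p ≤ 1 - p := by nlinarith
    calc ρ ^ 2 * p ^ 2 = (ρ * p) * (ρ * p) := by ring
      _ ≤ (ρ * p) * (1 - p) := mul_le_mul_of_nonneg_left this (by positivity)
      _ = _ := by ring
  simp only [Fintype.sum_bool, htt, htf, hff, pairLR_comm p ρ false true, bern]
  have hp2 : 0 < p * p := by positivity
  have hpq : 0 < p * (1 - p) := by positivity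
  have hqq : 0 < (1 - p) * (1 - p) := by positivity
  have d1 := mul_le_mul_of_nonneg_left b1 hp2.le
  have d2 := mul_le_mul_of_nonneg_left b2 hpq.le
  have d3 := mul_le_mul_of_nonneg_left b3 hqq.le
  have d4 := mul_le_mul_of_nonneg_left b4 hp2.le
  have hexp := Real.add_one_le_exp (7 * p ^ 2 * g ^ (7 / 6 : ℝ))
  nlinarith

/-- Quantitative form of the result, for one value of `n`. The vertex sets overlap in about
`s ^ 2 / n` vertices, and the truncation uses `K = √n` and the cutoff
`t = (s ^ 2 / n + 1) * γ ^ (1 / 6)`; the summand `1` covers `s = 0`. The lower bound `700` makes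
`7 * p ^ 2 * γ ^ (7 / 6) * t` at most `log n / 50`, which leaves the Chernoff factor `n ^ (-1 / 12)`
dominant. -/
theorem tv_le_of_sample_le {n s : ℕ} (hs : s ≤ n) (hn : 1 ≤ n) {p ρ : unitInterval}
    (hp0 : 0 < (p : ℝ)) (hp1 : (p : ℝ) ≤ 1 / 2) (hρ0 : 0 < (ρ : ℝ)) (hρ1 : (ρ : ℝ) < 1)
    {δ : ℝ} (hδ : 0 < δ)
    (hpn : (n : ℝ) ^ (-(1 / 100) : ℝ) ≤ p) (hlog : Real.log n ≤ (n : ℝ) ^ (1 / 100 : ℝ))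
    (hlog' : 700 ≤ Real.log n) (hγ1 : 1 ≤ gam p ρ) (hγ : 700 ≤ gam p ρ ^ δ)
    (hn' : (n : ℝ) ^ (-(1 / 50) : ℝ) ≤ 1 / 2)
    (hsample : (s : ℝ) ^ 2 / n * (p : ℝ) ^ 2 * gam p ρ ^ ((4 : ℝ) / 3 + δ) ≤ Real.log n) {η : ℝ}
    (hη : η = gam p ρ ^ (-(1 / 6) : ℝ) + (Real.exp (2 * (n : ℝ) ^ (-(1 / 50) : ℝ)) - 1)) :
    tv (P₀ n s hs p) (P₁ n s hs p ρ)
      ≤ (η + √(2 * (n : ℝ) ^ (-(1 / 50) : ℝ) + 2 * η)) / 2 := by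
  have hN : (1 : ℝ) ≤ n := by exact_mod_cast hn
  have hN0 : (0 : ℝ) < n := by linarith
  set g := gam p ρ with hg
  set m : ℝ := (s : ℝ) ^ 2 / n with hm
  have hg0 : 0 < g := by linarith
  have hm0 : 0 ≤ m := by positivity
  have hpg : (p : ℝ) * g ≤ 1 := by
    have : (p : ℝ) * g = ρ * (1 - p) := by
      rw [hg, gam]
      field_simp
    rw [this]
    nlinarith
  -- The sizes of `g`, `m` and the cutoff are small powers of `n`.
  have hpinv : (p : ℝ)⁻¹ ≤ (n : ℝ) ^ (1 / 100 : ℝ) := by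
    rw [inv_le_comm₀ hp0 (by positivity), ← Real.rpow_neg hN0.le]
    exact hpn
  have hgn : g ≤ (n : ℝ) ^ (1 / 100 : ℝ) := by
    refine le_trans ?_ hpinv
    rw [← one_div, le_div_iff₀ hp0, mul_comm]
    exact hpg
  have hmn : m ≤ (n : ℝ) ^ (3 / 100 : ℝ) := by
    have e1 : m * (p : ℝ) ^ 2 ≤ Real.log n := by
      refine le_trans (le_mul_of_one_le_right (by positivity) ?_) hsample
      exact Real.one_le_rpow hγ1 (by linarith)
    have e2 : m = m * (p : ℝ) ^ 2 * ((p : ℝ)⁻¹ * (p : ℝ)⁻¹) := by field_simp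
    have e3 : (3 / 100 : ℝ) = 1 / 100 + (1 / 100 + 1 / 100) := by norm_num
    rw [e2, e3, Real.rpow_add hN0, Real.rpow_add hN0]
    have : 0 < (p : ℝ)⁻¹ := inv_pos.2 hp0
    refine mul_le_mul (e1.trans hlog) (mul_le_mul hpinv hpinv this.le (by positivity))
      (by positivity) (by positivity)
  set t : ℝ := (m + 1) * g ^ (1 / 6 : ℝ) with ht
  have ht0 : 0 < t := by positivity
  have htn : t ≤ 2 * (n : ℝ) ^ (4 / 100 : ℝ) := by
    have e1 : g ^ (1 / 6 : ℝ) ≤ (n : ℝ) ^ (1 / 100 : ℝ) := by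
      refine le_trans ?_ hgn
      calc g ^ (1 / 6 : ℝ) ≤ g ^ (1 : ℝ) :=
            Real.rpow_le_rpow_of_exponent_le hγ1 (by norm_num)
        _ = g := Real.rpow_one g
    have e2 : m + 1 ≤ 2 * (n : ℝ) ^ (3 / 100 : ℝ) := by
      have : 1 ≤ (n : ℝ) ^ (3 / 100 : ℝ) := Real.one_le_rpow hN (by norm_num)
      linarith
    have e3 : (4 / 100 : ℝ) = 3 / 100 + 1 / 100 := by norm_num
    rw [e3, Real.rpow_add hN0, ← mul_assoc]
    exact mul_le_mul e2 e1 (by positivity) (by positivity)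
  set B : ℝ := 7 * (p : ℝ) ^ 2 * g ^ (7 / 6 : ℝ) with hB
  have hBt : B * t ≤ Real.log n * (1 / 50) := by
    have e1 : g ^ (7 / 6 : ℝ) * g ^ (1 / 6 : ℝ) = g ^ (4 / 3 : ℝ) := by
      rw [← Real.rpow_add hg0]
      norm_num
    have e2 : B * t = 7 * (m * (p : ℝ) ^ 2 * g ^ (4 / 3 : ℝ))
        + 7 * ((p : ℝ) ^ 2 * g ^ (4 / 3 : ℝ)) := by
      rw [hB, ht, ← e1]
      ring
    have e3 : m * (p : ℝ) ^ 2 * g ^ (4 / 3 : ℝ) * 700 ≤ Real.log n := by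
      refine le_trans ?_ hsample
      rw [Real.rpow_add hg0, ← mul_assoc]
      exact mul_le_mul_of_nonneg_left hγ (by positivity)
    have e4 : (p : ℝ) ^ 2 * g ^ (4 / 3 : ℝ) ≤ 1 := by
      calc (p : ℝ) ^ 2 * g ^ (4 / 3 : ℝ) ≤ (p : ℝ) ^ 2 * g ^ (2 : ℝ) := by
            refine mul_le_mul_of_nonneg_left ?_ (by positivity)
            exact Real.rpow_le_rpow_of_exponent_le hγ1 (by norm_num)
        _ = (p * g) ^ 2 := by
            rw [mul_pow]
            norm_num
        _ ≤ 1 := pow_le_one₀ (by positivity) hpg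
    rw [e2]
    linarith
  have hK : (0 : ℝ) < (n : ℝ) ^ (1 / 2 : ℝ) := by positivity
  have hq : ((n : ℝ) ^ (1 / 2 : ℝ)) ^ (-(1 / 6) : ℝ) * Real.exp (B * t) * t
      ≤ 2 * (n : ℝ) ^ (-(1 / 50) : ℝ) := by
    have e1 : Real.exp (B * t) ≤ (n : ℝ) ^ (1 / 50 : ℝ) := by
      rw [Real.rpow_def_of_pos hN0]
      exact Real.exp_le_exp.2 hBt
    calc ((n : ℝ) ^ (1 / 2 : ℝ)) ^ (-(1 / 6) : ℝ) * Real.exp (B * t) * t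
        ≤ ((n : ℝ) ^ (1 / 2 : ℝ)) ^ (-(1 / 6) : ℝ) * (n : ℝ) ^ (1 / 50 : ℝ)
            * (2 * (n : ℝ) ^ (4 / 100 : ℝ)) := by gcongr
      _ = 2 * (n : ℝ) ^ (1 / 2 * (-(1 / 6)) + 1 / 50 + 4 / 100 : ℝ) := by
          rw [← Real.rpow_mul hN0.le, Real.rpow_add hN0, Real.rpow_add hN0]
          ring
      _ ≤ _ := by
          refine mul_le_mul_of_nonneg_left ?_ (by norm_num)
          exact Real.rpow_le_rpow_of_exponent_le hN (by norm_num)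
  have hr : ((s : ℝ) / n) ^ 2 * (n : ℝ) ^ (1 / 2 : ℝ) ≤ (n : ℝ) ^ (-(1 / 50) : ℝ) := by
    have e1 : ((s : ℝ) / n) ^ 2 * (n : ℝ) ^ (1 / 2 : ℝ) = m * (n : ℝ) ^ (1 / 2 + (-1) : ℝ) := by
      rw [Real.rpow_add hN0, Real.rpow_neg_one, hm]
      field_simp
    calc _ ≤ (n : ℝ) ^ (3 / 100 : ℝ) * (n : ℝ) ^ (1 / 2 + (-1) : ℝ) := by
          rw [e1]
          exact mul_le_mul_of_nonneg_right hmn (by positivity)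
      _ = (n : ℝ) ^ (3 / 100 + (1 / 2 + (-1)) : ℝ) := (Real.rpow_add hN0 _ _).symm
      _ ≤ _ := Real.rpow_le_rpow_of_exponent_le hN (by norm_num)
  have hmark : m / t ≤ g ^ (-(1 / 6) : ℝ) := by
    rw [ht, Real.rpow_neg hg0.le, ← div_div, div_eq_mul_inv _ (g ^ (1 / 6 : ℝ))]
    refine mul_le_of_le_one_left (by positivity) ?_
    rw [div_le_one (by positivity)]
    linarith
  refine tv_sampled_le hs hp0 (by linarith) fun S₁ S₂ h₁ h₂ => ?_
  refine (expect_abs_sampledLR_sub_one_le hp0 (by linarith) hK (by positivity) ht0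
    (pairLR_moment_le hp0 hp1 hρ0 hρ1 hγ1) h₁ h₂ (hr.trans hn') (η := η) ?_).trans ?_
  · rw [hη]
    exact add_le_add hmark (sub_le_sub_right (Real.exp_le_exp.2 hq) 1)
  · gcongr

end SampledER

end

theorem proposition4p6
    (s : ℕ → ℕ) (p ρ : ℕ → unitInterval)
    (hs : ∀ n, s n ≤ n)
    (hp : ∀ n, 0 < (p n : ℝ) ∧ (p n : ℝ) ≤ 1 / 2)
    (hρ : ∀ n, 0 < (ρ n : ℝ) ∧ (ρ n : ℝ) < 1)
    -- `p = n ^ (-o(1))`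
    (a : ℕ → ℝ) (ha : Tendsto a atTop (𝓝 0))
    (hpa : ∀ᶠ n : ℕ in atTop, (p n : ℝ) = (n : ℝ) ^ (-a n))
    -- `γ = ω(1)`
    (hγ : Tendsto (fun n => SampledER.gam (p n) (ρ n)) atTop atTop)
    (δ : ℝ) (hδ : 0 < δ)
    (hsample : ∀ᶠ n : ℕ in atTop,
      (s n : ℝ) ^ 2 / (n : ℝ) * (p n : ℝ) ^ 2 *
        SampledER.gam (p n) (ρ n) ^ ((4 : ℝ) / 3 + δ) ≤ Real.log (n : ℝ)) :
    Tendsto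
      (fun n => SampledER.tv (SampledER.P₀ n (s n) (hs n) (p n))
        (SampledER.P₁ n (s n) (hs n) (p n) (ρ n)))
      atTop (𝓝 0) := by
  have hnat := tendsto_natCast_atTop_atTop (R := ℝ)
  have hpow : Tendsto (fun n : ℕ => (n : ℝ) ^ (-(1 / 50) : ℝ)) atTop (𝓝 0) :=
    (tendsto_rpow_neg_atTop (by norm_num)).comp hnat
  have hη : Tendsto (fun n => SampledER.gam (p n) (ρ n) ^ (-(1 / 6) : ℝ)
      + (Real.exp (2 * (n : ℝ) ^ (-(1 / 50) : ℝ)) - 1)) atTop (𝓝 0) := by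
    have h1 : Tendsto (fun n => SampledER.gam (p n) (ρ n) ^ (-(1 / 6) : ℝ)) atTop (𝓝 0) :=
      (tendsto_rpow_neg_atTop (by norm_num)).comp hγ
    have h2 := (Real.continuous_exp.tendsto _).comp (hpow.const_mul 2)
    simpa using h1.add (h2.sub_const 1)
  have hlim : Tendsto (fun n => ((SampledER.gam (p n) (ρ n) ^ (-(1 / 6) : ℝ)
      + (Real.exp (2 * (n : ℝ) ^ (-(1 / 50) : ℝ)) - 1))
      + √(2 * (n : ℝ) ^ (-(1 / 50) : ℝ) + 2 * (SampledER.gam (p n) (ρ n) ^ (-(1 / 6) : ℝ)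
      + (Real.exp (2 * (n : ℝ) ^ (-(1 / 50) : ℝ)) - 1)))) / 2) atTop (𝓝 0) := by
    have h := (hη.add ((Real.continuous_sqrt.tendsto _).comp
      ((hpow.const_mul 2).add (hη.const_mul 2)))).div_const 2
    simpa using h
  refine squeeze_zero' (Eventually.of_forall fun n => SampledER.tv_nonneg _ _) ?_ hlim
  have e1 : ∀ᶠ n : ℕ in atTop, Real.log n ≤ (n : ℝ) ^ (1 / 100 : ℝ) := by
    have h := (isLittleO_log_rpow_atTop (r := 1 / 100) (by norm_num)).bound one_pos
    filter_upwards [hnat.eventually h] with n hn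
    rw [one_mul, Real.norm_of_nonneg (Real.rpow_nonneg (Nat.cast_nonneg n) _)] at hn
    exact (le_abs_self _).trans hn
  have e2 : ∀ᶠ n : ℕ in atTop, 700 ≤ Real.log n :=
    (Real.tendsto_log_atTop.comp hnat).eventually_ge_atTop 700
  have e3 : ∀ᶠ n : ℕ in atTop, 700 ≤ SampledER.gam (p n) (ρ n) ^ δ :=
    ((tendsto_rpow_atTop hδ).comp hγ).eventually_ge_atTop 700
  have e4 : ∀ᶠ n : ℕ in atTop, (n : ℝ) ^ (-(1 / 50) : ℝ) ≤ 1 / 2 :=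
    hpow.eventually_le_const (by norm_num)
  have e5 : ∀ᶠ n : ℕ in atTop, a n ≤ 1 / 100 := ha.eventually_le_const (by norm_num)
  filter_upwards [hsample, hpa, e1, e2, e3, e4, e5, hγ.eventually_ge_atTop 1,
    eventually_ge_atTop 1] with n hsn hpn h1 h2 h3 h4 h5 h6 h7
  refine SampledER.tv_le_of_sample_le (hs n) h7 (hp n).1 (hp n).2 (hρ n).1 (hρ n).2 hδ ?_ h1 h2
    h6 h3 h4 hsn rfl
  rw [hpn]
  exact Real.rpow_le_rpow_of_exponent_le (by exact_mod_cast h7) (by linarith)
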